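/- Let $\{p_k\}_{k\ge 0}$ be a probability distribution on $\{0,1,2,\dots\}$ with mean $\mu=\sum_k k p_k\in(1,\infty]$ and probability generating function $f(s)=\sum_k p_k s^k$. Let $q<1$ be the extinction probability of the Galton–Watson process with offspring distribution $\{p_k\}$ and one progenitor. Put $\lambda_c:=f'(q)$ if $p_0>0$ and $\lambda_c:=0$ if $p_0=0$. Let $\mathbb P$ (with expectation $\mathbb E$) be the law of the Galton–Watson tree $\mathbf T$ with this offspring distribution, conditioned to survive. For a rooted, locally finite tree $\mathscr T$ with root $e$, let $\pi(x)$ be the parent of $x\neq e$ and $\nu(x)$ the number of children of $x$. For $\lambda>0$, the $\lambda$-biased random walk $(Z_n)_{n\ge0}$ on $\mathscr T$ is the Markov chain, with law $P^{\mathscr T}_\lambda$, which starts at the root and moves from $x\ne e$ to $\pi(x)$ with probability $\lambda/(\lambda+\nu(x))$ and to each child of $x$ with probability $1/(\lambda+\nu(x))$, and from $e$ to each child of $e$ with probability $1/\nu(e)$. Let $\mathscr T^*$ be the tree obtained from $\mathscr T$ by adding a new vertex $e^*$, which is the root of $\mathscr T^*$ and the parent of $e$, and let $\sigma_{e^*}:=\inf\{n\ge1: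 Z_n=e^*\}$ (with $\inf\emptyset=\infty$). Then the annealed escape probability $$\lambda\longmapsto \mathbb E\big[P^{\mathbf T^*}_\lambda(\sigma_{e^*}=\infty)\big]$$ is well defined (the integrand is $\mathbb P$-integrable) and continuous on $(\lambda_c,\mu)$. -/

import Mathlib

open MeasureTheory ProbabilityTheory
open scoped ENNReal

/-- A locally finite rooted tree with vertex set `V`, given by its parent map: exactly the root has
no parent, there is no infinite line of ancestors (so every vertex descends from the root), and
every vertex has finitely many children. -/
structure LocFinRootedTree (V : Type*) where
  root : V
  parent : V → Option V
  parent_eq_none_iff : ∀ x, parent x = none ↔ x = root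
  wellFounded : WellFounded fun x y => parent y = some x
  finite_children : ∀ x, {y | parent y = some x}.Finite

namespace LocFinRootedTree

variable {V : Type*}

/-- The number `ν(x)` of children of `x`. -/
noncomputable def numChildren (T : LocFinRootedTree V) (x : V) : ℕ :=
  {y | T.parent y = some x}.ncard

/-- The tree `T^*`: a new root `none` (written `e^*`) is added as the parent of the old root. -/
def star (T : LocFinRootedTree V) : LocFinRootedTree (Option V) where
  root := none
  parent := fun x => x.map T.parent
  parent_eq_none_iff := by
    intro x
    cases x <;> simp
  wellFounded := by
    have hnone : Acc (fun x y : Option V => y.map T.parent = some x) none :=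
      Acc.intro _ (fun y hy => by simp at hy)
    have hsome : ∀ v : V, Acc (fun x y : Option V => y.map T.parent = some x) (some v) := by
      intro v
      induction v using T.wellFounded.induction with
      | _ v ih =>
        refine Acc.intro _ (fun y hy => ?_)
        simp only [Option.map_some, Option.some.injEq] at hy
        cases y with
        | none => exact hnone
        | some w => exact ih w hy
    refine ⟨fun x => ?_⟩
    cases x with
    | none => exact hnone
    | some v => exact hsome v
  finite_children := by
    intro x
    cases x with
    | none =>
      refine (Set.finite_singleton (some T.root)).subset ?_
      intro y hy
      cases y with
      | none => simp at hy
      | some v =>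
        have hv : T.parent v = none := by simpa using hy
        simp [(T.parent_eq_none_iff v).1 hv]
    | some v =>
      refine ((T.finite_children v).image some).subset ?_
      intro y hy
      cases y with
      | none => simp at hy
      | some w => exact ⟨w, by simpa using hy, rfl⟩

open Classical in
/-- The transition probabilities `A_l(x, y)` of the `l`-biased random walk on `T`. -/
noncomputable def trans (T : LocFinRootedTree V) (l : ℝ) (x y : V) : ℝ :=
  if T.parent x = some y then l / (l + T.numChildren x)
  else if T.parent y = some x then
    if x = T.root then 1 / T.numChildren x else 1 / (l + T.numChildren x)
  else 0

open Classical in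
/-- The law of one step of the `l`-biased walk from `x`, with weights `A_l(x, ·)`.
The second branch (the walk stays put) only occurs when these weights are not a probability
distribution; by `stepPMF_apply` this cannot happen if `0 < l` and the root has a child. -/
noncomputable def stepPMF (T : LocFinRootedTree V) (l : ℝ) (x : V) : PMF V :=
  if h : HasSum (fun y => ENNReal.ofReal (T.trans l x y)) 1 then ⟨_, h⟩ else PMF.pure x

theorem stepPMF_apply (T : LocFinRootedTree V) {l : ℝ} (hl : 0 < l) (hroot : T.numChildren T.root ≠ 0)
    (x y : V) : T.stepPMF l x y = ENNReal.ofReal (T.trans l x y) := by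
  classical
  suffices h : HasSum (fun y => ENNReal.ofReal (T.trans l x y)) 1 by
    have h2 : T.stepPMF l x = (⟨_, h⟩ : PMF V) := dif_pos h
    rw [h2]; rfl
  set S : Finset V := (T.finite_children x).toFinset with hS
  have hcard : (S.card : ℝ) = T.numChildren x := by
    rw [numChildren, Set.ncard_eq_toFinset_card _ (T.finite_children x)]
  have hmem : ∀ z, z ∈ S ↔ T.parent z = some x := fun z => by simp [hS]
  have hasym : ∀ z, T.parent x = some z → T.parent z ≠ some x := fun z h1 h2 =>
    (T.wellFounded.asymmetric (r := fun x y => T.parent y = some x)) x z h2 h1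
  have hn : (0 : ℝ) ≤ T.numChildren x := Nat.cast_nonneg _
  rcases hx : T.parent x with _ | w
  · have hxr : x = T.root := (T.parent_eq_none_iff x).1 hx
    have hval : ∀ z ∈ S, T.trans l x z = 1 / T.numChildren x := fun z hz => by
      rw [trans, if_neg (by simp [hx]), if_pos ((hmem z).1 hz), if_pos hxr]
    have hout : ∀ z ∉ S, ENNReal.ofReal (T.trans l x z) = 0 := fun z hz => by
      rw [hmem] at hz
      simp [trans, hx, hz]
    have hsum : ∑ z ∈ S, ENNReal.ofReal (T.trans l x z) = 1 := by
      rw [← ENNReal.ofReal_sum_of_nonneg (fun z hz => by rw [hval z hz]; positivity),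
        Finset.sum_congr rfl hval, Finset.sum_const, nsmul_eq_mul, hcard, mul_one_div,
        div_self, ENNReal.ofReal_one]
      rw [hxr]; exact_mod_cast hroot
    rw [← hsum]; exact hasSum_sum_of_ne_finset_zero hout
  · have hxr : x ≠ T.root := fun h => by
      rw [(T.parent_eq_none_iff x).2 h] at hx; simp at hx
    have hwS : w ∉ S := fun h => hasym w hx ((hmem w).1 h)
    have hwval : T.trans l x w = l / (l + T.numChildren x) := by simp [trans, hx]
    have hval : ∀ z ∈ S, T.trans l x z = 1 / (l + T.numChildren x) := fun z hz => by
      have hzw : w ≠ z := fun h => hwS (h ▸ hz)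
      simp [trans, hx, (hmem z).1 hz, hxr, hzw]
    have hout : ∀ z ∉ insert w S, ENNReal.ofReal (T.trans l x z) = 0 := fun z hz => by
      rw [Finset.mem_insert, not_or, hmem] at hz
      simp [trans, hx, hz.2, Ne.symm hz.1]
    have hsum : ∑ z ∈ insert w S, ENNReal.ofReal (T.trans l x z) = 1 := by
      rw [Finset.sum_insert hwS,
        ← ENNReal.ofReal_sum_of_nonneg (fun z hz => by rw [hval z hz]; positivity),
        Finset.sum_congr rfl hval, Finset.sum_const, nsmul_eq_mul, hcard, hwval,
        ← ENNReal.ofReal_add (by positivity) (by positivity), mul_one_div, ← add_div,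
        div_self (by positivity), ENNReal.ofReal_one]
    rw [← hsum]; exact hasSum_sum_of_ne_finset_zero hout

variable [MeasurableSpace V] [DiscreteMeasurableSpace V]

/-- The transition kernel of the `l`-biased random walk. -/
noncomputable def stepKernel (T : LocFinRootedTree V) (l : ℝ) : Kernel V V where
  toFun x := (T.stepPMF l x).toMeasure
  measurable' := Measurable.of_discrete

instance (T : LocFinRootedTree V) (l : ℝ) : IsMarkovKernel (T.stepKernel l) :=
  ⟨fun x => PMF.toMeasure.isProbabilityMeasure (T.stepPMF l x)⟩

/-- The law `P_{l,x}^T` on path space of the `l`-biased random walk `(Z_n)` on `T` with `Z_0 = x`: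
given `(Z_0, …, Z_n)`, the next position has the law `stepKernel` at `Z_n`. -/
noncomputable def walkLawFrom (T : LocFinRootedTree V) (l : ℝ) (x : V) : Measure (ℕ → V) :=
  Kernel.trajMeasure (X := fun _ => V) (Measure.dirac x)
    (fun n => (T.stepKernel l).comap
      (fun z : (i : Finset.Iic n) → V => z ⟨n, Finset.mem_Iic.2 le_rfl⟩) (measurable_pi_apply _))

/-- The quenched law `P_l^T` of the `l`-biased random walk started from the root. -/
noncomputable def walkLaw (T : LocFinRootedTree V) (l : ℝ) : Measure (ℕ → V) :=
  T.walkLawFrom l T.root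

end LocFinRootedTree

/-- The first return time `σ_x = inf {n ≥ 1 : Z_n = x}` of a path, with `inf ∅ = ∞`. -/
noncomputable def returnTime {V : Type*} (x : V) (Z : ℕ → V) : ℕ∞ :=
  sInf ((fun n : ℕ => (n : ℕ∞)) '' {n | 1 ≤ n ∧ Z n = x})

namespace GaltonWatson

/-- A field of offspring numbers: individuals are labelled by words (the last-born letter comes
first), `[]` is the progenitor, and `i :: x` with `i < ω x` are the children of `x`. -/
abbrev OffspringField := List ℕ → ℕ

/-- The word `x` labels an individual of the family tree of `ω`. -/
def IsVertex (ω : OffspringField) : List ℕ → Prop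
  | [] => True
  | i :: x => IsVertex ω x ∧ i < ω x

/-- The individuals of the family tree of `ω`. -/
@[ext] structure Vertex (ω : OffspringField) where
  word : List ℕ
  isVertex : IsVertex ω word

instance (ω : OffspringField) : MeasurableSpace (Vertex ω) := ⊤

instance (ω : OffspringField) : MeasurableSpace (Option (Vertex ω)) := ⊤

instance (ω : OffspringField) : DiscreteMeasurableSpace (Vertex ω) := ⟨fun _ => trivial⟩

instance (ω : OffspringField) : DiscreteMeasurableSpace (Option (Vertex ω)) := ⟨fun _ => trivial⟩

/-- The parent of an individual. -/
def parent (ω : OffspringField) : Vertex ω → Option (Vertex ω)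
  | ⟨[], _⟩ => none
  | ⟨_ :: x, h⟩ => some ⟨x, h.1⟩

/-- The family tree of `ω`. -/
def tree (ω : OffspringField) : LocFinRootedTree (Vertex ω) where
  root := ⟨[], trivial⟩
  parent := parent ω
  parent_eq_none_iff := by
    rintro ⟨x, hx⟩
    cases x with
    | nil => exact ⟨fun _ => rfl, fun _ => rfl⟩
    | cons i x => simp only [parent, reduceCtorEq, false_iff]; intro h; cases h
  wellFounded := by
    refine Subrelation.wf ?_ (InvImage.wf (fun v : Vertex ω => v.word.length) Nat.lt_wfRel.wf)
    rintro ⟨x, hx⟩ ⟨y, hy⟩ h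
    cases y with
    | nil => cases h
    | cons i y =>
      cases h
      exact Nat.lt_succ_self _
  finite_children := by
    rintro ⟨x, hx⟩
    refine Set.Finite.subset
      (Set.finite_range (fun i : Fin (ω x) => (⟨i.1 :: x, hx, i.2⟩ : Vertex ω))) ?_
    rintro ⟨y, hy⟩ h
    cases y with
    | nil => cases h
    | cons i y =>
      cases h
      exact ⟨⟨i, hy.2⟩, rfl⟩

/-- The size `W_n` of the `n`-th generation. -/
noncomputable def genSize (ω : OffspringField) (n : ℕ) : ℕ :=
  {x : List ℕ | IsVertex ω x ∧ x.length = n}.ncard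

/-- The law under which the offspring numbers are i.i.d. with distribution `p`. -/
noncomputable def law (p : PMF ℕ) : Measure OffspringField :=
  Measure.infinitePi (fun _ : List ℕ => p.toMeasure)

/-- The event of survival: no generation is empty. -/
def survival : Set OffspringField := {ω | ∀ n, genSize ω n ≠ 0}

/-- The law of the Galton-Watson tree conditioned to survive. -/
noncomputable def survivalLaw (p : PMF ℕ) : Measure OffspringField :=
  ProbabilityTheory.cond (law p) survival

/-- The extinction probability `q`. -/
noncomputable def extinctionProb (p : PMF ℕ) : ℝ := (law p).real survivalᶜ

/-- The mean `μ` of the offspring distribution, in `[0, ∞]`. -/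
noncomputable def mean (p : PMF ℕ) : ℝ≥0∞ := ∑' k : ℕ, (k : ℝ≥0∞) * p k

/-- The probability generating function `f`. -/
noncomputable def genFun (p : PMF ℕ) (s : ℝ) : ℝ := ∑' k : ℕ, (p k).toReal * s ^ k

/-- The critical bias `λ_c`: it is `f'(q)` if `p_0 > 0`, and `0` if `p_0 = 0`. -/
noncomputable def criticalBias (p : PMF ℕ) : ℝ :=
  if p 0 = 0 then 0 else deriv (genFun p) (extinctionProb p)

/-- The quenched escape probability `P_l^{T^*}(σ_{e^*} = ∞)`, where `T` is the tree of `ω`. -/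
noncomputable def escapeProb (l : ℝ) (ω : OffspringField) : ℝ :=
  ((tree ω).star.walkLaw l).real {Z | returnTime (tree ω).star.root Z = ⊤}

end GaltonWatson

/-!
The escape probability `β_l` of a tree is the decreasing limit of the escape probabilities of the
tree cut at generation `n`, and satisfies `β_l = S / (l + S)`, where `S` is the sum of `β_l` over the
subtrees of the children of the root (`escapeProb_eq`, `escapeLimit_eq`). It is decreasing in `l`, and
left-continuous as a decreasing limit of continuous functions. Its right limit `g` at `l` satisfies the
same recursion, and `g ≤ β_l`. So it suffices to show that `g = β_l` almost surely; the theorem then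
follows by dominated convergence.

That solutions of the recursion are unique in this sense is `ae_eq_of_solution_of_one_lt_mean`. The
probability that a solution vanishes is a fixed point of the offspring generating function. Below `1`
there is only one (`fixed_point_unique`), so `g` and `β_l` vanish on the same trees, once `g` is known
to be positive with positive probability. This holds because for any bias below the mean the walk is
transient with positive probability (`measure_escapeLimit_eq_zero_lt_one`), which follows from a
recursion for Laplace transforms.

Given this, `g` is compared with `b = β_l` through electrical networks (`ae_eq_of_solution`). In the
tree cut at generation `n`, with escape probability `1` at the individuals of generation `n` whose
subtree has `b > 0`, consider the unit current flow. The network of `g` is obtained by placing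
resistances of order `1 / g` at these individuals. Let the flow pass only through those with `g ≥ ε`. By
the branching property the flow loses on average at most the proportion `P(g < ε | b > 0)` of its mass
(`lintegral_flowMean_mul_le`), which is small. The additional resistances cost at most `1 / ε` times the
energy of the flow in the last generation, which tends to `0` because the resistances of the cut trees
converge when `b > 0` (`flowEnergy_succ_le`). By Thomson's principle (`sq_one_sub_flowMean_le`),
`E[g] ≥ E[b] - 2 P(g < ε | b > 0)`, and letting `ε → 0` gives `E[g] = E[b]`.
-/

/-! ### Resampling one coordinate of a product measure -/

theorem measurable_update_prod {ι : Type*} [DecidableEq ι] {X : ι → Type*}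
    [∀ i, MeasurableSpace (X i)] (i : ι) :
    Measurable (fun q : X i × (∀ j, X j) => Function.update q.2 i q.1) := by
  refine measurable_pi_iff.2 fun j => ?_
  by_cases h : j = i
  · subst h; simpa using measurable_fst
  · simp only [Function.update_of_ne h]
    exact (measurable_pi_apply j).comp measurable_snd

/-- Replacing the coordinate `i` of a sample of a product measure by an independent sample of
`μ i` does not change the law. -/
theorem MeasureTheory.Measure.map_update_infinitePi {ι : Type*} [DecidableEq ι] {X : ι → Type*}
    [∀ i, MeasurableSpace (X i)] (μ : (i : ι) → Measure (X i)) [∀ i, IsProbabilityMeasure (μ i)]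
    (i : ι) :
    ((μ i).prod (Measure.infinitePi μ)).map (fun q => Function.update q.2 i q.1) =
      Measure.infinitePi μ := by
  have hmeas := measurable_update_prod (X := X) i
  refine Measure.eq_infinitePi μ fun s t ht => ?_
  rw [Measure.map_apply hmeas (.pi s.countable_toSet fun _ _ => ht _)]
  by_cases hi : i ∈ s
  · have : (fun q : X i × (∀ j, X j) => Function.update q.2 i q.1) ⁻¹' ((s : Set ι).pi t) =
        t i ×ˢ (((s.erase i : Finset ι) : Set ι).pi t) := by
      ext q
      simp only [Set.mem_preimage, Set.mem_pi, Set.mem_prod, Finset.mem_coe, Finset.mem_erase]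
      constructor
      · intro h
        refine ⟨by simpa using h i hi, fun j hj => by simpa [hj.1] using h j hj.2⟩
      · rintro ⟨h1, h2⟩ j hj
        by_cases hji : j = i
        · subst hji; simpa using h1
        · simpa [hji] using h2 j ⟨hji, hj⟩
    rw [this, Measure.prod_prod, Measure.infinitePi_pi _ (fun j _ => ht j),
      Finset.mul_prod_erase s (fun j => μ j (t j)) hi]
  · have : (fun q : X i × (∀ j, X j) => Function.update q.2 i q.1) ⁻¹' ((s : Set ι).pi t) =
        Set.univ ×ˢ ((s : Set ι).pi t) := by
      ext q
      simp only [Set.mem_preimage, Set.mem_pi, Set.mem_prod, Finset.mem_coe, Set.mem_univ,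
        true_and]
      refine forall₂_congr fun j hj => ?_
      have : j ≠ i := fun h => hi (h ▸ hj)
      simp [this]
    rw [this, Measure.prod_prod, Measure.infinitePi_pi _ (fun j _ => ht j)]
    simp

/-! ### The branching property -/

namespace GaltonWatson

instance (p : PMF ℕ) : IsProbabilityMeasure p.toMeasure := PMF.toMeasure.isProbabilityMeasure p

instance (p : PMF ℕ) : IsProbabilityMeasure (law p) := by unfold law; infer_instance

/-- The offspring field seen from the potential child `i` of the progenitor. Since the last-born
letter comes first, the descendants of `[i]` are the words `y ++ [i]`. -/
def subfield (ω : OffspringField) (i : ℕ) : OffspringField := fun y => ω (y ++ [i])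

/-- The sum of the values of `F` over the subtrees rooted at the children of the progenitor. -/
def childSum (F : OffspringField → ℝ) (ω : OffspringField) : ℝ :=
  ∑ i ∈ Finset.range (ω []), F (subfield ω i)

/-- The law of an i.i.d. sequence of offspring fields. By `map_subfield_law` it is the joint law
of the subtrees at all potential children of the progenitor. -/
noncomputable def childLaw (p : PMF ℕ) : Measure (ℕ → OffspringField) :=
  Measure.infinitePi (fun _ : ℕ => law p)

instance (p : PMF ℕ) : IsProbabilityMeasure (childLaw p) := by unfold childLaw; infer_instance

@[fun_prop]
theorem measurable_subfield : Measurable subfield :=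
  measurable_pi_iff.2 fun i => measurable_pi_iff.2 fun y => measurable_pi_apply (y ++ [i])

theorem map_subfield_law (p : PMF ℕ) : (law p).map subfield = childLaw p := by
  have hinj : Function.Injective (fun q : ℕ × List ℕ => q.2 ++ [q.1]) := by
    rintro ⟨i, x⟩ ⟨j, y⟩ h
    have := List.append_inj' h rfl
    simp_all
  have h1 := Measure.map_infinitePi_infinitePi_of_inj (P := fun _ : List ℕ => p.toMeasure) hinj
  have h2 := Measure.infinitePi_map_curry (fun (_ : ℕ) (_ : List ℕ) => p.toMeasure)
  rw [← h1, Measure.map_map (by fun_prop) (by fun_prop)] at h2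
  exact h2

/-- The branching property: the subtrees at the children are independent of the number of
children of the progenitor, and have the joint law `childLaw p`. -/
theorem lintegral_branch (p : PMF ℕ) {F : ℕ → (ℕ → OffspringField) → ℝ≥0∞}
    (hF : ∀ k, Measurable (F k)) :
    ∫⁻ ω, F (ω []) (subfield ω) ∂(law p) = ∑' k, p k * ∫⁻ η, F k η ∂(childLaw p) := by
  have hF' : Measurable (Function.uncurry F) := measurable_from_prod_countable_right hF
  have hG : Measurable (fun ω : OffspringField => F (ω []) (subfield ω)) :=
    hF'.comp ((measurable_pi_apply []).prodMk measurable_subfield)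
  have hup := measurable_update_prod (X := fun _ : List ℕ => ℕ) []
  have hsub : ∀ (ω : OffspringField) k, subfield (Function.update ω [] k) = subfield ω := by
    intro ω k; ext i y; simp [subfield]
  have h := Measure.map_update_infinitePi (fun _ : List ℕ => p.toMeasure) []
  change (p.toMeasure.prod (law p)).map _ = law p at h
  conv_lhs => rw [← h]
  rw [lintegral_map hG hup]
  simp only [Function.update_self, hsub]
  rw [lintegral_prod _ (by
    exact (hF'.comp (measurable_fst.prodMk (measurable_subfield.comp measurable_snd))).aemeasurable)]
  rw [lintegral_countable']
  refine tsum_congr fun k => ?_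
  rw [mul_comm, PMF.toMeasure_apply_singleton _ _ (measurableSet_singleton k), ← map_subfield_law,
    lintegral_map (hF k) measurable_subfield]

theorem lintegral_childLaw_update (p : PMF ℕ) (i : ℕ) {F : (ℕ → OffspringField) → ℝ≥0∞}
    (hF : Measurable F) :
    ∫⁻ η, F η ∂(childLaw p) =
      ∫⁻ η, ∫⁻ y, F (Function.update η i y) ∂(law p) ∂(childLaw p) := by
  have h := Measure.map_update_infinitePi (fun _ : ℕ => law p) i
  change ((law p).prod (childLaw p)).map _ = childLaw p at h
  have hup := measurable_update_prod (X := fun _ : ℕ => OffspringField) i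
  conv_lhs => rw [← h]
  rw [lintegral_map hF hup, lintegral_prod_symm (fun q => F (Function.update q.2 i q.1))
    (hF.comp hup).aemeasurable]

theorem lintegral_prod_childLaw (p : PMF ℕ) {f : OffspringField → ℝ≥0∞} (hf : Measurable f)
    (k : ℕ) :
    ∫⁻ η, ∏ i ∈ Finset.range k, f (η i) ∂(childLaw p) = (∫⁻ ω, f ω ∂(law p)) ^ k := by
  induction k with
  | zero => simp
  | succ k ih =>
    have hm : Measurable fun η : ℕ → OffspringField => ∏ i ∈ Finset.range (k + 1), f (η i) :=
      Finset.measurable_prod _ fun i _ => hf.comp (measurable_pi_apply i)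
    have hm' : Measurable fun η : ℕ → OffspringField => ∏ i ∈ Finset.range k, f (η i) :=
      Finset.measurable_prod _ fun i _ => hf.comp (measurable_pi_apply i)
    have hprod : ∀ (η : ℕ → OffspringField) y,
        ∏ i ∈ Finset.range (k + 1), f (Function.update η k y i) =
          (∏ i ∈ Finset.range k, f (η i)) * f y := by
      intro η y
      rw [Finset.prod_range_succ, Function.update_self]
      congr 1
      refine Finset.prod_congr rfl fun i hi => ?_
      rw [Function.update_of_ne (Finset.mem_range.1 hi).ne]
    rw [lintegral_childLaw_update p k hm, pow_succ, ← ih]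
    simp_rw [hprod, lintegral_const_mul _ hf]
    rw [lintegral_mul_const _ hm']

theorem lintegral_prod_subfield (p : PMF ℕ) {f : OffspringField → ℝ≥0∞} (hf : Measurable f) :
    ∫⁻ ω, ∏ i ∈ Finset.range (ω []), f (subfield ω i) ∂(law p) =
      ∑' k, p k * (∫⁻ ω, f ω ∂(law p)) ^ k := by
  rw [lintegral_branch p (F := fun k η => ∏ i ∈ Finset.range k, f (η i))
    fun k => Finset.measurable_prod _ fun i _ => hf.comp (measurable_pi_apply i)]
  simp_rw [lintegral_prod_childLaw p hf]

@[fun_prop]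
theorem measurable_childSum {F : OffspringField → ℝ} (hF : Measurable F) :
    Measurable (childSum F) := by
  have : Measurable (Function.uncurry
      fun (k : ℕ) (η : ℕ → OffspringField) => ∑ i ∈ Finset.range k, F (η i)) :=
    measurable_from_prod_countable_right fun k => by
      change Measurable fun η : ℕ → OffspringField => ∑ i ∈ Finset.range k, F (η i)
      exact Finset.measurable_sum _ fun i _ => hF.comp (measurable_pi_apply i)
  exact this.comp ((measurable_pi_apply []).prodMk measurable_subfield)

end GaltonWatson

/-! ### Two finite inequalities from the Cauchy-Schwarz inequality -/

/-- The step of Thomson's principle from the subtrees of the children to the whole tree: `X i` is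
the escape probability of a subtree, and `1 / B i + c * A i` the energy of a flow through it of
which the part `S i` is kept. -/
theorem sq_weighted_mean_le {ι : Type*} (s : Finset ι) {l c : ℝ} (hl : 0 < l)
    {X B S A : ι → ℝ} (hX : ∀ i ∈ s, 0 ≤ X i) (hB : ∀ i ∈ s, 0 ≤ B i)
    (hA : ∀ i ∈ s, 0 ≤ A i) (hc : 0 ≤ c) (hS0 : ∀ i ∈ s, 0 ≤ S i) (hS1 : ∀ i ∈ s, S i ≤ 1)
    (h : ∀ i ∈ s, 0 < B i → S i ^ 2 ≤ X i * (1 / B i + c * A i)) (hpos : 0 < ∑ i ∈ s, B i) :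
    ((∑ i ∈ s, B i * S i) / ∑ i ∈ s, B i) ^ 2 ≤
      ((∑ i ∈ s, X i) / (l + ∑ i ∈ s, X i)) *
        (1 / ((∑ i ∈ s, B i) / (l + ∑ i ∈ s, B i)) +
          c * (l * (∑ i ∈ s, B i ^ 2 * A i) / (∑ i ∈ s, B i) ^ 2)) := by
  have hcs : (∑ i ∈ s, B i * S i) ^ 2 ≤
      (∑ i ∈ s, X i) * ∑ i ∈ s, (B i + c * (B i ^ 2 * A i)) := by
    refine Finset.sum_sq_le_sum_mul_sum_of_sq_le_mul s hX (fun i hi => ?_) fun i hi => ?_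
    · have := hB i hi; have := hA i hi; positivity
    · rcases (hB i hi).eq_or_lt with h0 | h0
      · simp [← h0]
      · have := mul_le_mul_of_nonneg_left (h i hi h0) (sq_nonneg (B i))
        calc (B i * S i) ^ 2 = B i ^ 2 * S i ^ 2 := by ring
          _ ≤ _ := this
          _ = _ := by field_simp
  rw [Finset.sum_add_distrib, ← Finset.mul_sum] at hcs
  have hM0 : 0 ≤ ∑ i ∈ s, B i * S i :=
    Finset.sum_nonneg fun i hi => mul_nonneg (hB i hi) (hS0 i hi)
  have hM1 : ∑ i ∈ s, B i * S i ≤ ∑ i ∈ s, B i :=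
    Finset.sum_le_sum fun i hi => mul_le_of_le_one_right (hB i hi) (hS1 i hi)
  have hY : 0 ≤ ∑ i ∈ s, X i := Finset.sum_nonneg hX
  generalize (∑ i ∈ s, B i * S i) = M at *
  generalize (∑ i ∈ s, X i) = Y at *
  generalize (∑ i ∈ s, B i) = T at *
  generalize (∑ i ∈ s, B i ^ 2 * A i) = Q at *
  have hM2 : M ^ 2 ≤ T ^ 2 := by gcongr
  have e : Y / (l + Y) * (1 / (T / (l + T)) + c * (l * Q / T ^ 2)) =
      (Y * (T ^ 2 + l * T + c * l * Q)) / (T ^ 2 * (l + Y)) := by field_simp; ring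
  rw [e, div_pow, div_le_div_iff₀ (by positivity) (by positivity)]
  have h1 := mul_le_mul_of_nonneg_left hcs hl.le
  have h2 := mul_le_mul_of_nonneg_left hM2 hY
  have h3 : M ^ 2 * (l + Y) ≤ Y * (T ^ 2 + l * T + c * l * Q) := by nlinarith
  have := mul_le_mul_of_nonneg_right h3 (sq_nonneg T)
  nlinarith

/-- The step from the subtrees of the children to the whole tree in `flowEnergy_succ_le`. -/
theorem weighted_energy_le {ι : Type*} (s : Finset ι) {l : ℝ} (hl : 0 < l)
    {B B' A : ι → ℝ} (hB' : ∀ i ∈ s, 0 ≤ B' i) (hBB' : ∀ i ∈ s, B' i ≤ B i)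
    (h : ∀ i ∈ s, 0 < B' i → A i ≤ 1 / B' i - 1 / B i) (hpos : 0 < ∑ i ∈ s, B' i) :
    l * (∑ i ∈ s, B' i ^ 2 * A i) / (∑ i ∈ s, B' i) ^ 2 ≤
      1 / ((∑ i ∈ s, B' i) / (l + ∑ i ∈ s, B' i)) - 1 / ((∑ i ∈ s, B i) / (l + ∑ i ∈ s, B i)) := by
  have hsum : ∑ i ∈ s, B' i ^ 2 * A i ≤ ∑ i ∈ s, (B' i - B' i ^ 2 / B i) := by
    refine Finset.sum_le_sum fun i hi => ?_
    rcases (hB' i hi).eq_or_lt with h0 | h0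
    · simp [← h0]
    · have hb : 0 < B i := h0.trans_le (hBB' i hi)
      calc B' i ^ 2 * A i ≤ B' i ^ 2 * (1 / B' i - 1 / B i) := by gcongr; exact h i hi h0
        _ = _ := by field_simp
  have hcs : (∑ i ∈ s, B' i) ^ 2 ≤ (∑ i ∈ s, B' i ^ 2 / B i) * ∑ i ∈ s, B i := by
    refine Finset.sum_sq_le_sum_mul_sum_of_sq_le_mul s (fun i hi => ?_) (fun i hi => ?_)
      fun i hi => ?_
    · have := (hB' i hi).trans (hBB' i hi); positivity
    · exact (hB' i hi).trans (hBB' i hi)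
    · rcases (hB' i hi).eq_or_lt with h0 | h0
      · simp [← h0]
      · have hb : 0 < B i := h0.trans_le (hBB' i hi)
        rw [div_mul_cancel₀ _ hb.ne']
  rw [Finset.sum_sub_distrib] at hsum
  have hTT : ∑ i ∈ s, B' i ≤ ∑ i ∈ s, B i := Finset.sum_le_sum hBB'
  generalize (∑ i ∈ s, B' i ^ 2 * A i) = Q at *
  generalize (∑ i ∈ s, B' i ^ 2 / B i) = R at *
  generalize (∑ i ∈ s, B' i) = T' at *
  generalize (∑ i ∈ s, B i) = T at *
  have hT : 0 < T := hpos.trans_le hTT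
  have hQ : Q * T ≤ T' * T - T' ^ 2 := by nlinarith
  have e : 1 / (T' / (l + T')) - 1 / (T / (l + T)) = l * (T' * T - T' ^ 2) / (T' ^ 2 * T) := by
    field_simp; ring
  rw [e, div_le_div_iff₀ (by positivity) (by positivity)]
  have := mul_le_mul_of_nonneg_left hQ (show 0 ≤ l * T' ^ 2 by positivity)
  nlinarith

/-! ### Escape probabilities of cut trees, and the flows they define -/

namespace GaltonWatson

/-- The map `F ↦ childSum F / (l + childSum F)` applied `n` times to `ζ`. For `ζ = 1` it is the
escape probability in the tree cut at generation `n`; in general `ζ`, evaluated at the subtrees of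
the individuals of generation `n`, prescribes the escape probabilities there. -/
noncomputable def escapeIter (l : ℝ) (ζ : OffspringField → ℝ) : ℕ → OffspringField → ℝ
  | 0 => ζ
  | n + 1 => fun ω => childSum (escapeIter l ζ n) ω / (l + childSum (escapeIter l ζ n) ω)

/-- Consider the unit flow which splits, at each individual of a generation below `n`, in
proportion to the values of `escapeIter` at the subtrees of the children. If `θ x` is the flow through
`x`, then `flowMean l ζ δ n` is the sum of `θ x * δ` over the individuals `x` of generation `n`, with `δ`
evaluated at the subtree of `x`. A division by zero gives the zero flow in a subtree through
which nothing can flow. -/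
noncomputable def flowMean (l : ℝ) (ζ δ : OffspringField → ℝ) : ℕ → OffspringField → ℝ
  | 0 => δ
  | n + 1 => fun ω => childSum (fun η => escapeIter l ζ n η * flowMean l ζ δ n η) ω /
      childSum (escapeIter l ζ n) ω

/-- For the flow `θ` described at `flowMean`, the energy `l ^ n * ∑ θ x ^ 2` dissipated in the edges
from generation `n - 1` to generation `n`. -/
noncomputable def flowEnergy (l : ℝ) (ζ : OffspringField → ℝ) : ℕ → OffspringField → ℝ
  | 0 => fun _ => 1
  | n + 1 => fun ω => l * childSum (fun η => escapeIter l ζ n η ^ 2 * flowEnergy l ζ n η) ω /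
      childSum (escapeIter l ζ n) ω ^ 2

theorem childSum_nonneg {F : OffspringField → ℝ} (hF : ∀ ω, 0 ≤ F ω) (ω) : 0 ≤ childSum F ω :=
  Finset.sum_nonneg fun _ _ => hF _

theorem childSum_mono {F G : OffspringField → ℝ} (h : ∀ ω, F ω ≤ G ω) (ω) :
    childSum F ω ≤ childSum G ω :=
  Finset.sum_le_sum fun _ _ => h _

section deterministic

variable {l : ℝ} {ζ δ : OffspringField → ℝ}

theorem div_add_mono {l s t : ℝ} (hl : 0 < l) (hs : 0 ≤ s) (hst : s ≤ t) :
    s / (l + s) ≤ t / (l + t) := by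
  rw [div_le_div_iff₀ (by positivity) (by linarith)]
  nlinarith

theorem escapeIter_nonneg (hl : 0 < l) (hζ : ∀ ω, 0 ≤ ζ ω) (n ω) : 0 ≤ escapeIter l ζ n ω := by
  induction n generalizing ω with
  | zero => exact hζ ω
  | succ n ih =>
    have := childSum_nonneg ih ω
    simp only [escapeIter]; positivity

theorem escapeIter_le_one (hl : 0 < l) (hζ : ∀ ω, 0 ≤ ζ ω) (hζ1 : ∀ ω, ζ ω ≤ 1) (n ω) :
    escapeIter l ζ n ω ≤ 1 := by
  cases n with
  | zero => exact hζ1 ω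
  | succ n =>
    have := childSum_nonneg (escapeIter_nonneg hl hζ n) ω
    simp only [escapeIter]
    exact div_le_one_of_le₀ (by linarith) (by linarith)

theorem escapeIter_antitone (hl : 0 < l) (hζ : ∀ ω, 0 ≤ ζ ω)
    (h : ∀ ω, escapeIter l ζ 1 ω ≤ ζ ω) (ω) : Antitone fun n => escapeIter l ζ n ω := by
  refine antitone_nat_of_succ_le fun n => ?_
  induction n generalizing ω with
  | zero => exact h ω
  | succ n ih =>
    exact div_add_mono hl (childSum_nonneg (escapeIter_nonneg hl hζ (n + 1)) ω) (childSum_mono ih ω)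

theorem le_escapeIter {F : OffspringField → ℝ} (hl : 0 < l) (hF0 : ∀ ω, 0 ≤ F ω)
    (hF : ∀ ω, F ω = childSum F ω / (l + childSum F ω)) (hFζ : ∀ ω, F ω ≤ ζ ω) (n ω) :
    F ω ≤ escapeIter l ζ n ω := by
  induction n generalizing ω with
  | zero => exact hFζ ω
  | succ n ih =>
    rw [hF]
    exact div_add_mono hl (childSum_nonneg hF0 ω) (childSum_mono ih ω)

theorem measurable_escapeIter (hζ : Measurable ζ) (n) : Measurable (escapeIter l ζ n) := by
  induction n with
  | zero => exact hζ
  | succ n ih => simp only [escapeIter]; fun_prop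

theorem measurable_flowMean (hζ : Measurable ζ) (hδ : Measurable δ) (n) :
    Measurable (flowMean l ζ δ n) := by
  induction n with
  | zero => exact hδ
  | succ n ih =>
    have := measurable_escapeIter (l := l) hζ n
    simp only [flowMean]; fun_prop

theorem measurable_flowEnergy (hζ : Measurable ζ) (n) :
    Measurable (flowEnergy l ζ n) := by
  induction n with
  | zero => exact measurable_const
  | succ n ih =>
    have := measurable_escapeIter (l := l) hζ n
    simp only [flowEnergy]; fun_prop

theorem flowEnergy_nonneg (hl : 0 < l) (n ω) : 0 ≤ flowEnergy l ζ n ω := by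
  induction n generalizing ω with
  | zero => exact zero_le_one
  | succ n ih =>
    have := childSum_nonneg (F := fun η => escapeIter l ζ n η ^ 2 * flowEnergy l ζ n η)
      (fun η => mul_nonneg (sq_nonneg _) (ih η)) ω
    simp only [flowEnergy]; positivity

theorem flowMean_nonneg (hl : 0 < l) (hζ : ∀ ω, 0 ≤ ζ ω) (hδ : ∀ ω, 0 ≤ δ ω) (n ω) :
    0 ≤ flowMean l ζ δ n ω := by
  induction n generalizing ω with
  | zero => exact hδ ω
  | succ n ih =>
    exact div_nonneg (childSum_nonneg (fun η => mul_nonneg (escapeIter_nonneg hl hζ n η) (ih η)) ω)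
      (childSum_nonneg (escapeIter_nonneg hl hζ n) ω)

theorem flowMean_le_one (hl : 0 < l) (hζ : ∀ ω, 0 ≤ ζ ω) (hδ : ∀ ω, δ ω ≤ 1) (n ω) :
    flowMean l ζ δ n ω ≤ 1 := by
  induction n generalizing ω with
  | zero => exact hδ ω
  | succ n ih =>
    exact div_le_one_of_le₀
      (childSum_mono (fun η => mul_le_of_le_one_right (escapeIter_nonneg hl hζ n η) (ih η)) ω)
      (childSum_nonneg (escapeIter_nonneg hl hζ n) ω)

theorem childSum_pos_of_escapeIter_pos (hl : 0 < l) (hζ : ∀ ω, 0 ≤ ζ ω) {n ω}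
    (h : 0 < escapeIter l ζ (n + 1) ω) : 0 < childSum (escapeIter l ζ n) ω := by
  refine (childSum_nonneg (escapeIter_nonneg hl hζ n) ω).lt_of_ne fun h0 => ?_
  simp [escapeIter, ← h0] at h

/-- Thomson's principle for the flow of `flowMean` from which the fraction `δ` is removed in
generation `n`: the escape probability `F` is at least the squared strength of the remaining flow
divided by the energy of the flow, where each individual in generation `n` carries an additional
resistance, `c` times that of the edge to its parent. -/
theorem sq_one_sub_flowMean_le {F : OffspringField → ℝ} {c : ℝ} (hl : 0 < l) (hc : 0 ≤ c)
    (hF0 : ∀ ω, 0 ≤ F ω) (hF : ∀ ω, F ω = childSum F ω / (l + childSum F ω))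
    (hζ : ∀ ω, 0 ≤ ζ ω) (hδ0 : ∀ ω, 0 ≤ δ ω) (hδ1 : ∀ ω, δ ω ≤ 1)
    (h : ∀ ω, 0 < ζ ω → (1 - δ ω) ^ 2 ≤ F ω * (1 / ζ ω + c)) (n ω)
    (hpos : 0 < escapeIter l ζ n ω) :
    (1 - flowMean l ζ δ n ω) ^ 2 ≤
      F ω * (1 / escapeIter l ζ n ω + c * flowEnergy l ζ n ω) := by
  induction n generalizing ω with
  | zero => simpa [flowMean, escapeIter, flowEnergy] using h ω hpos
  | succ n ih =>
    have hp := childSum_pos_of_escapeIter_pos hl hζ hpos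
    have hB := escapeIter_nonneg hl hζ n
    have key := sq_weighted_mean_le (Finset.range (ω [])) hl (c := c)
      (X := fun i => F (subfield ω i)) (B := fun i => escapeIter l ζ n (subfield ω i))
      (S := fun i => 1 - flowMean l ζ δ n (subfield ω i))
      (A := fun i => flowEnergy l ζ n (subfield ω i))
      (fun i _ => hF0 _) (fun i _ => hB _) (fun i _ => flowEnergy_nonneg hl n _) hc
      (fun i _ => sub_nonneg.2 (flowMean_le_one hl hζ hδ1 n _))
      (fun i _ => by linarith [flowMean_nonneg hl hζ hδ0 n (subfield ω i)])
      (fun i _ hi => ih _ hi) hp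
    rw [hF]
    refine le_trans (le_of_eq ?_) key
    simp only [flowMean, childSum, mul_sub, mul_one, Finset.sum_sub_distrib, sub_div]
    rw [div_self]
    exact hp.ne'

/-- The energy in the last generation is bounded by the increase of the resistance when one more
generation is added, because the flow is also admissible in the tree without the last generation. -/
theorem flowEnergy_succ_le (hl : 0 < l) (hζ : ∀ ω, 0 ≤ ζ ω)
    (hζ1 : ∀ ω, 0 < ζ ω → ζ ω = 1) (h : ∀ ω, escapeIter l ζ 1 ω ≤ ζ ω) (n ω)
    (hpos : 0 < escapeIter l ζ (n + 1) ω) :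
    flowEnergy l ζ (n + 1) ω ≤ 1 / escapeIter l ζ (n + 1) ω - 1 / escapeIter l ζ n ω := by
  induction n generalizing ω with
  | zero =>
    have hp := childSum_pos_of_escapeIter_pos hl hζ hpos
    have h1 : ζ ω = 1 := hζ1 ω (hpos.trans_le (h ω))
    have h2 : childSum (fun η => ζ η ^ 2) ω = childSum ζ ω := by
      refine Finset.sum_congr rfl fun i _ => ?_
      rcases (hζ (subfield ω i)).eq_or_lt with h0 | h0
      · simp [← h0]
      · simp [hζ1 _ h0]
    simp only [escapeIter] at hp ⊢
    simp only [flowEnergy, escapeIter, mul_one, h1, h2]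
    apply le_of_eq
    field_simp
    ring
  | succ n ih =>
    have hp := childSum_pos_of_escapeIter_pos hl hζ hpos
    exact weighted_energy_le (Finset.range (ω [])) hl
      (fun i _ => escapeIter_nonneg hl hζ (n + 1) _)
      (fun i _ => escapeIter_antitone hl hζ h _ n.le_succ) (fun i _ hi => ih _ hi) hp

end deterministic

/-! ### Uniqueness of the positive solution -/

/-- The flow of `flowMean` loses on average at most the proportion `C` of its mass. The test
function `ψ` of `escapeIter` makes the induction on `n` work: the proportion of the flow that a child
receives depends on its subtree through `escapeIter` only. -/
theorem lintegral_flowMean_mul_le (p : PMF ℕ) {l : ℝ} (hl : 0 < l) {ζ δ : OffspringField → ℝ}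
    (hζm : Measurable ζ) (hδm : Measurable δ) (hζ : ∀ ω, 0 ≤ ζ ω) (hδ : ∀ ω, 0 ≤ δ ω) {C : ℝ≥0∞}
    (h : ∀ ψ : ℝ → ℝ≥0∞, Measurable ψ →
      ∫⁻ ω, ENNReal.ofReal (δ ω) * ψ (ζ ω) ∂(law p) ≤ C * ∫⁻ ω, ψ (ζ ω) ∂(law p))
    (n : ℕ) (ψ : ℝ → ℝ≥0∞) (hψ : Measurable ψ) :
    ∫⁻ ω, ENNReal.ofReal (flowMean l ζ δ n ω) * ψ (escapeIter l ζ n ω) ∂(law p) ≤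
      C * ∫⁻ ω, ψ (escapeIter l ζ n ω) ∂(law p) := by
  induction n generalizing ψ with
  | zero => exact h ψ hψ
  | succ n ih =>
    set B := escapeIter l ζ n with hBdef
    set D := flowMean l ζ δ n with hDdef
    have hB : ∀ ω, 0 ≤ B ω := escapeIter_nonneg hl hζ n
    have hD : ∀ ω, 0 ≤ D ω := flowMean_nonneg hl hζ hδ n
    have hBm : Measurable B := measurable_escapeIter hζm n
    have hDm : Measurable D := measurable_flowMean hζm hδm n
    have hsm : ∀ s : Finset ℕ, Measurable fun η : ℕ → OffspringField => ∑ i ∈ s, B (η i) :=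
      fun s => Finset.measurable_sum _ fun i _ => hBm.comp (measurable_pi_apply i)
    have hφ : Measurable fun s : ℝ => ψ (s / (l + s)) := hψ.comp (by fun_prop)
    have hterm : ∀ i : ℕ, Measurable fun η : ℕ → OffspringField => B (η i) :=
      fun i => hBm.comp (measurable_pi_apply i)
    have htermD : ∀ i : ℕ, Measurable fun η : ℕ → OffspringField => D (η i) :=
      fun i => hDm.comp (measurable_pi_apply i)
    -- the bound for one child, whose subtree is resampled with all the others fixed
    have key : ∀ k, ∀ i ∈ Finset.range k,
        ∫⁻ η, ENNReal.ofReal (B (η i) / ∑ j ∈ Finset.range k, B (η j)) *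
            (ENNReal.ofReal (D (η i)) *
              ψ ((∑ j ∈ Finset.range k, B (η j)) / (l + ∑ j ∈ Finset.range k, B (η j))))
            ∂(childLaw p) ≤
        C * ∫⁻ η, ENNReal.ofReal (B (η i) / ∑ j ∈ Finset.range k, B (η j)) *
              ψ ((∑ j ∈ Finset.range k, B (η j)) / (l + ∑ j ∈ Finset.range k, B (η j)))
            ∂(childLaw p) := by
      intro k i hi
      have hupd : ∀ (η : ℕ → OffspringField) y,
          ∑ j ∈ Finset.range k, B (Function.update η i y j) =
            B y + ∑ j ∈ (Finset.range k).erase i, B (η j) := by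
        intro η y
        rw [← Finset.add_sum_erase _ _ hi, Function.update_self]
        congr 1
        refine Finset.sum_congr rfl fun j hj => ?_
        rw [Function.update_of_ne (Finset.ne_of_mem_erase hj)]
      have hm1 : Measurable fun η : ℕ → OffspringField =>
          ENNReal.ofReal (B (η i) / ∑ j ∈ Finset.range k, B (η j)) :=
        ((hterm i).div (hsm _)).ennreal_ofReal
      have hm2 : Measurable fun η : ℕ → OffspringField =>
          ψ ((∑ j ∈ Finset.range k, B (η j)) / (l + ∑ j ∈ Finset.range k, B (η j))) :=
        hφ.comp (hsm _)
      have hm12 : Measurable fun η : ℕ → OffspringField =>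
          ENNReal.ofReal (B (η i) / ∑ j ∈ Finset.range k, B (η j)) *
            ψ ((∑ j ∈ Finset.range k, B (η j)) / (l + ∑ j ∈ Finset.range k, B (η j))) :=
        hm1.mul hm2
      have hm1D2 : Measurable fun η : ℕ → OffspringField =>
          ENNReal.ofReal (B (η i) / ∑ j ∈ Finset.range k, B (η j)) * (ENNReal.ofReal (D (η i)) *
            ψ ((∑ j ∈ Finset.range k, B (η j)) / (l + ∑ j ∈ Finset.range k, B (η j)))) :=
        hm1.mul ((htermD i).ennreal_ofReal.mul hm2)
      rw [lintegral_childLaw_update p i hm1D2, lintegral_childLaw_update p i hm12]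
      simp only [hupd, Function.update_self]
      have hin : ∀ R : ℝ, ∫⁻ y, ENNReal.ofReal (B y / (B y + R)) *
            (ENNReal.ofReal (D y) * ψ ((B y + R) / (l + (B y + R)))) ∂(law p) ≤
          C * ∫⁻ y, ENNReal.ofReal (B y / (B y + R)) *
            ψ ((B y + R) / (l + (B y + R))) ∂(law p) := by
        intro R
        have := ih (fun t => ENNReal.ofReal (t / (t + R)) * ψ ((t + R) / (l + (t + R))))
          ((by fun_prop : Measurable fun t : ℝ => t / (t + R)).ennreal_ofReal.mul
            (hφ.comp (measurable_id.add_const R)))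
        refine le_trans (le_of_eq ?_) this
        refine lintegral_congr fun y => ?_
        ring
      have hm3 : Measurable fun η : ℕ → OffspringField => ∫⁻ y,
          ENNReal.ofReal (B y / (B y + ∑ j ∈ (Finset.range k).erase i, B (η j))) *
            ψ ((B y + ∑ j ∈ (Finset.range k).erase i, B (η j)) /
              (l + (B y + ∑ j ∈ (Finset.range k).erase i, B (η j)))) ∂(law p) := by
        have hs : Measurable fun q : (ℕ → OffspringField) × OffspringField =>
            B q.2 + ∑ j ∈ (Finset.range k).erase i, B (q.1 j) :=
          (hBm.comp measurable_snd).add ((hsm _).comp measurable_fst)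
        refine Measurable.lintegral_prod_right' (f := fun q : (ℕ → OffspringField) × OffspringField =>
          ENNReal.ofReal (B q.2 / (B q.2 + ∑ j ∈ (Finset.range k).erase i, B (q.1 j))) *
            ψ ((B q.2 + ∑ j ∈ (Finset.range k).erase i, B (q.1 j)) /
              (l + (B q.2 + ∑ j ∈ (Finset.range k).erase i, B (q.1 j))))) ?_
        exact ((hBm.comp measurable_snd).div hs).ennreal_ofReal.mul (hφ.comp hs)
      rw [← lintegral_const_mul _ hm3]
      exact lintegral_mono fun η => hin _
    have hL := lintegral_branch p (F := fun k η => ENNReal.ofReal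
        ((∑ i ∈ Finset.range k, B (η i) * D (η i)) / ∑ j ∈ Finset.range k, B (η j)) *
          ψ ((∑ j ∈ Finset.range k, B (η j)) / (l + ∑ j ∈ Finset.range k, B (η j))))
      fun k => ((Finset.measurable_sum _ fun i _ => (hterm i).mul (htermD i)).div
        (hsm _)).ennreal_ofReal.mul (hφ.comp (hsm _))
    have hR := lintegral_branch p (F := fun k η =>
          ψ ((∑ j ∈ Finset.range k, B (η j)) / (l + ∑ j ∈ Finset.range k, B (η j))))
      fun k => hφ.comp (hsm _)
    change ∫⁻ ω, ENNReal.ofReal (flowMean l ζ δ (n + 1) ω) * ψ (escapeIter l ζ (n + 1) ω) ∂(law p)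
      = _ at hL
    change ∫⁻ ω, ψ (escapeIter l ζ (n + 1) ω) ∂(law p) = _ at hR
    rw [hL, hR, ← ENNReal.tsum_mul_left]
    refine ENNReal.tsum_le_tsum fun k => ?_
    rw [mul_left_comm]
    gcongr
    calc _ = ∑ i ∈ Finset.range k,
          ∫⁻ η, ENNReal.ofReal (B (η i) / ∑ j ∈ Finset.range k, B (η j)) *
            (ENNReal.ofReal (D (η i)) *
              ψ ((∑ j ∈ Finset.range k, B (η j)) / (l + ∑ j ∈ Finset.range k, B (η j))))
            ∂(childLaw p) := by
          rw [← lintegral_finsetSum]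
          · refine lintegral_congr fun η => ?_
            have hT : 0 ≤ ∑ j ∈ Finset.range k, B (η j) := Finset.sum_nonneg fun j _ => hB _
            rw [Finset.sum_div, ENNReal.ofReal_sum_of_nonneg
              fun i _ => div_nonneg (mul_nonneg (hB _) (hD _)) hT, Finset.sum_mul]
            refine Finset.sum_congr rfl fun i _ => ?_
            rw [mul_div_right_comm, ENNReal.ofReal_mul (div_nonneg (hB _) hT), mul_assoc]
          · exact fun i _ => ((hterm i).div (hsm _)).ennreal_ofReal.mul
              ((htermD i).ennreal_ofReal.mul (hφ.comp (hsm _)))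
      _ ≤ ∑ i ∈ Finset.range k,
          C * ∫⁻ η, ENNReal.ofReal (B (η i) / ∑ j ∈ Finset.range k, B (η j)) *
              ψ ((∑ j ∈ Finset.range k, B (η j)) / (l + ∑ j ∈ Finset.range k, B (η j)))
            ∂(childLaw p) := Finset.sum_le_sum (key k)
      _ ≤ _ := by
          rw [← Finset.mul_sum]
          gcongr
          rw [← lintegral_finsetSum]
          · refine lintegral_mono fun η => ?_
            have hT : 0 ≤ ∑ j ∈ Finset.range k, B (η j) := Finset.sum_nonneg fun j _ => hB _
            rw [← Finset.sum_mul, ← ENNReal.ofReal_sum_of_nonneg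
              fun i _ => div_nonneg (hB _) hT, ← Finset.sum_div]
            refine mul_le_of_le_one_left' ?_
            rw [ENNReal.ofReal_le_one]
            exact div_self_le_one _
          · exact fun i _ => ((hterm i).div (hsm _)).ennreal_ofReal.mul (hφ.comp (hsm _))

/-- Two ordered solutions of the recursion which vanish on the same trees agree almost surely.
Starting from the flow in the tree cut at generation `n`, the individuals `x` of generation `n` with
`b > 0` but `g < ε` at `x` are removed: this loses little mass if `ε` is small, and the resistances at
most `1 / ε` added in generation `n` cost little energy if `n` is large. -/
theorem ae_eq_of_solution (p : PMF ℕ) {l : ℝ} (hl : 0 < l) {g b : OffspringField → ℝ}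
    (hgm : Measurable g) (hbm : Measurable b) (hg0 : ∀ ω, 0 ≤ g ω) (hgb : ∀ ω, g ω ≤ b ω)
    (hb1 : ∀ ω, b ω ≤ 1) (hg : ∀ ω, g ω = childSum g ω / (l + childSum g ω))
    (hb : ∀ ω, b ω = childSum b ω / (l + childSum b ω))
    (hzero : ∀ᵐ ω ∂(law p), g ω = 0 → b ω = 0) : g =ᵐ[law p] b := by
  have hb0 : ∀ ω, 0 ≤ b ω := fun ω => (hg0 ω).trans (hgb ω)
  set P := law p
  have hfin : ∫⁻ ω, ENNReal.ofReal (g ω) ∂P ≠ ⊤ := by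
    refine ne_top_of_le_ne_top ENNReal.one_ne_top ?_
    calc ∫⁻ ω, ENNReal.ofReal (g ω) ∂P ≤ ∫⁻ _, 1 ∂P :=
          lintegral_mono fun ω => ENNReal.ofReal_le_one.2 ((hgb ω).trans (hb1 ω))
      _ = 1 := by simp
  suffices hmain : ∫⁻ ω, ENNReal.ofReal (b ω) ∂P ≤ ∫⁻ ω, ENNReal.ofReal (g ω) ∂P by
    have := ae_eq_of_ae_le_of_lintegral_le
      (ae_of_all P fun ω => ENNReal.ofReal_le_ofReal (hgb ω)) hfin
      hbm.ennreal_ofReal.aemeasurable hmain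
    filter_upwards [this] with ω hω
    exact (ENNReal.ofReal_eq_ofReal_iff (hg0 ω) (hb0 ω)).1 hω
  have hSm : MeasurableSet {ω | 0 < b ω} := measurableSet_lt measurable_const hbm
  by_cases hP0 : P {ω | 0 < b ω} = 0
  · have : ∀ᵐ ω ∂P, ENNReal.ofReal (b ω) = 0 := by
      have h : ∀ᵐ ω ∂P, ¬ 0 < b ω := measure_eq_zero_iff_ae_notMem.1 hP0
      filter_upwards [h] with ω hω
      exact ENNReal.ofReal_eq_zero.2 (not_lt.1 hω)
    rw [lintegral_congr_ae this]
    simp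
  -- only individuals whose subtree has `b > 0` receive flow
  let ζ : OffspringField → ℝ := {ω | 0 < b ω}.indicator 1
  have hζm : Measurable ζ := measurable_one.indicator hSm
  have hζ0 : ∀ ω, 0 ≤ ζ ω := Set.indicator_nonneg fun _ _ => zero_le_one
  have hζpos : ∀ ω, 0 < ζ ω → ζ ω = 1 := by
    intro ω h
    by_cases hω : ω ∈ {ω | 0 < b ω}
    · exact Set.indicator_of_mem hω _
    · simp [ζ, Set.indicator_of_notMem hω] at h
  have hbζ : ∀ ω, b ω ≤ ζ ω := by
    intro ω
    by_cases hω : ω ∈ {ω | 0 < b ω}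
    · simpa [ζ, Set.indicator_of_mem hω] using hb1 ω
    · simpa [ζ, Set.indicator_of_notMem hω] using hω
  have hζ1 : ∀ ω, ζ ω ≤ 1 := by
    intro ω
    by_cases hω : ω ∈ {ω | 0 < b ω}
    · simp [ζ, Set.indicator_of_mem hω]
    · simp [ζ, Set.indicator_of_notMem hω]
  have hstep : ∀ ω, escapeIter l ζ 1 ω ≤ ζ ω := by
    intro ω
    by_cases hω : ω ∈ {ω | 0 < b ω}
    · have : ζ ω = 1 := Set.indicator_of_mem hω _
      rw [this]; exact escapeIter_le_one hl hζ0 hζ1 1 ω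
    · have h0 : ∀ i ∈ Finset.range (ω []), ζ (subfield ω i) = 0 := by
        have hbω : b ω = 0 := le_antisymm (not_lt.1 hω) (hb0 ω)
        rw [hb] at hbω
        have hs := childSum_nonneg hb0 ω
        have : childSum b ω = 0 := by
          rcases div_eq_zero_iff.1 hbω with h | h
          · exact h
          · linarith
        intro i hi
        have := (Finset.sum_eq_zero_iff_of_nonneg fun i _ => hb0 _).1 this i hi
        exact Set.indicator_of_notMem (by simp [this]) _
      have : childSum ζ ω = 0 := Finset.sum_eq_zero h0
      simpa [escapeIter, this] using hζ0 ω
  -- the bound at each level `ε = 1 / (m + 1)`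
  have hbound : ∀ m : ℕ, ∫⁻ ω, ENNReal.ofReal (b ω) ∂P ≤ ∫⁻ ω, ENNReal.ofReal (g ω) ∂P +
      2 * (P {ω | 0 < b ω ∧ g ω < 1 / ((m : ℝ) + 1)} / P {ω | 0 < b ω}) := by
    intro m
    set C := P {ω | 0 < b ω ∧ g ω < 1 / ((m : ℝ) + 1)} / P {ω | 0 < b ω} with hC
    have hEm : MeasurableSet {ω | 0 < b ω ∧ g ω < 1 / ((m : ℝ) + 1)} :=
      hSm.inter (measurableSet_lt hgm measurable_const)
    let δ : OffspringField → ℝ := {ω | 0 < b ω ∧ g ω < 1 / ((m : ℝ) + 1)}.indicator 1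
    have hδm : Measurable δ := measurable_one.indicator hEm
    have hδ0 : ∀ ω, 0 ≤ δ ω := Set.indicator_nonneg fun _ _ => zero_le_one
    have hδ1 : ∀ ω, δ ω ≤ 1 := fun ω =>
      Set.indicator_le_self' (f := fun _ => (1 : ℝ)) (fun _ _ => zero_le_one) ω
    have hbase : ∀ ψ : ℝ → ℝ≥0∞, Measurable ψ →
        ∫⁻ ω, ENNReal.ofReal (δ ω) * ψ (ζ ω) ∂P ≤ C * ∫⁻ ω, ψ (ζ ω) ∂P := by
      intro ψ hψ
      have h1 : ∀ ω, ENNReal.ofReal (δ ω) * ψ (ζ ω) =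
          {ω | 0 < b ω ∧ g ω < 1 / ((m : ℝ) + 1)}.indicator (fun _ => ψ 1) ω := by
        intro ω
        by_cases hω : ω ∈ {ω | 0 < b ω ∧ g ω < 1 / ((m : ℝ) + 1)}
        · have h2 : ω ∈ {ω | 0 < b ω} := hω.1
          simp only [δ, ζ, Set.indicator_of_mem hω, Set.indicator_of_mem h2]
          simp
        · simp only [δ, Set.indicator_of_notMem hω]
          simp
      have h2 : ψ 1 * P {ω | 0 < b ω} ≤ ∫⁻ ω, ψ (ζ ω) ∂P := by
        rw [← lintegral_indicator_const hSm]
        refine lintegral_mono fun ω => ?_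
        by_cases hω : ω ∈ {ω | 0 < b ω}
        · simp only [ζ, Set.indicator_of_mem hω]
          simp
        · simp only [Set.indicator_of_notMem hω]
          simp
      rw [lintegral_congr h1, lintegral_indicator_const hEm]
      calc ψ 1 * P {ω | 0 < b ω ∧ g ω < 1 / ((m : ℝ) + 1)}
          = C * (ψ 1 * P {ω | 0 < b ω}) := by
            rw [hC, mul_left_comm, ENNReal.div_mul_cancel hP0 (measure_ne_top _ _)]
        _ ≤ _ := by gcongr
    have hdet : ∀ ω, 0 < ζ ω → (1 - δ ω) ^ 2 ≤ g ω * (1 / ζ ω + m) := by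
      intro ω hω
      rw [hζpos ω hω]
      by_cases hE : ω ∈ {ω | 0 < b ω ∧ g ω < 1 / ((m : ℝ) + 1)}
      · have : δ ω = 1 := Set.indicator_of_mem hE _
        rw [this]
        have := hg0 ω
        rw [sub_self, zero_pow two_ne_zero]
        positivity
      · have h3 : δ ω = 0 := Set.indicator_of_notMem hE _
        have h4 : 0 < b ω := by
          by_contra h
          have : ζ ω = 0 := Set.indicator_of_notMem (s := {ω | 0 < b ω}) h _
          linarith
        have h5 : 1 / ((m : ℝ) + 1) ≤ g ω := by
          by_contra h
          exact hE ⟨h4, not_le.1 h⟩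
        rw [h3]
        rw [div_le_iff₀ (by positivity)] at h5
        linarith
    set B := escapeIter l ζ with hBdef
    set A := flowEnergy l ζ with hAdef
    set D := flowMean l ζ δ with hDdef
    have hB0 : ∀ n ω, 0 ≤ B n ω := escapeIter_nonneg hl hζ0
    have hA0 : ∀ n ω, 0 ≤ A n ω := flowEnergy_nonneg hl
    have hD0 : ∀ n ω, 0 ≤ D n ω := flowMean_nonneg hl hζ0 hδ0
    have hBm : ∀ n, Measurable (B n) := measurable_escapeIter hζm
    have hAm : ∀ n, Measurable (A n) := measurable_flowEnergy hζm
    have hDm : ∀ n, Measurable (D n) := measurable_flowMean hζm hδm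
    -- the reciprocal of the energy, written so that it is `0` where `B n` vanishes
    let V : ℕ → OffspringField → ℝ := fun n ω => B n ω / (1 + m * A n ω * B n ω)
    have hVm : ∀ n, Measurable (V n) := fun n =>
      (hBm n).div (measurable_const.add ((measurable_const.mul (hAm n)).mul (hBm n)))
    have hV : ∀ n ω, V n ω ≤ g ω + 2 * D n ω := by
      intro n ω
      rcases (hB0 n ω).eq_or_lt with h0 | h0
      · have := hg0 ω; have := hD0 n ω
        simp only [V, ← h0]; simp; positivity
      · have h1 := sq_one_sub_flowMean_le hl (Nat.cast_nonneg m) hg0 hg hζ0 hδ0 hδ1 hdet n ω h0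
        have hd : 0 < 1 + m * A n ω * B n ω := by
          have := hA0 n ω; positivity
        have hV1 : V n ω ≤ 1 := by
          have := hA0 n ω
          have h2 : B n ω ≤ 1 := escapeIter_le_one hl hζ0 hζ1 n ω
          refine div_le_one_of_le₀ ?_ hd.le
          have : 0 ≤ m * A n ω * B n ω := by positivity
          linarith
        have hV0 : 0 ≤ V n ω := div_nonneg (hB0 n ω) hd.le
        have e : 1 / B n ω + m * A n ω = 1 / V n ω := by
          simp only [V]; field_simp
        have hVp : 0 < V n ω := div_pos h0 hd
        have h2 : (1 - D n ω) ^ 2 * V n ω ≤ g ω := by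
          have h3 : (1 - D n ω) ^ 2 ≤ g ω * (1 / B n ω + m * A n ω) := h1
          rw [e, mul_one_div, le_div_iff₀ hVp] at h3
          exact h3
        nlinarith [hD0 n ω, sq_nonneg (D n ω), mul_nonneg (hD0 n ω) (sub_nonneg.2 hV1),
          mul_nonneg (sq_nonneg (D n ω)) hV0]
    have hintV : ∀ n, ∫⁻ ω, ENNReal.ofReal (V n ω) ∂P ≤
        ∫⁻ ω, ENNReal.ofReal (g ω) ∂P + 2 * C := by
      intro n
      have h1 := lintegral_flowMean_mul_le p hl hζm hδm hζ0 hδ0 hbase n (fun _ => 1)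
        measurable_const
      simp only [mul_one, lintegral_const, measure_univ] at h1
      calc ∫⁻ ω, ENNReal.ofReal (V n ω) ∂P
          ≤ ∫⁻ ω, (ENNReal.ofReal (g ω) + 2 * ENNReal.ofReal (D n ω)) ∂P := by
            refine lintegral_mono fun ω => ?_
            refine (ENNReal.ofReal_le_ofReal (hV n ω)).trans (le_of_eq ?_)
            rw [ENNReal.ofReal_add (hg0 ω) (by have := hD0 n ω; positivity),
              ENNReal.ofReal_mul (by norm_num)]
            simp
        _ = ∫⁻ ω, ENNReal.ofReal (g ω) ∂P + 2 * ∫⁻ ω, ENNReal.ofReal (D n ω) ∂P := by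
            rw [lintegral_add_left hgm.ennreal_ofReal,
              lintegral_const_mul _ (hDm n).ennreal_ofReal]
        _ ≤ _ := by gcongr
    have hlim : ∀ ω, ENNReal.ofReal (b ω) ≤
        Filter.liminf (fun n => ENNReal.ofReal (V n ω)) Filter.atTop := by
      intro ω
      rcases (hb0 ω).eq_or_lt with h0 | h0
      · simp [← h0]
      have hbB : ∀ n, b ω ≤ B n ω := fun n => le_escapeIter hl hb0 hb hbζ n ω
      have hanti : Antitone fun n => B n ω := escapeIter_antitone hl hζ0 hstep ω
      have hbdd : BddBelow (Set.range fun n => B n ω) := ⟨b ω, by rintro _ ⟨n, rfl⟩; exact hbB n⟩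
      have hBt := tendsto_atTop_ciInf hanti hbdd
      set β := ⨅ n, B n ω
      have hβ : b ω ≤ β := le_ciInf hbB
      have hβ0 : 0 < β := h0.trans_le hβ
      have hinv : Filter.Tendsto (fun n => 1 / B (n + 1) ω - 1 / B n ω) Filter.atTop (nhds 0) := by
        have h1 : Filter.Tendsto (fun n => 1 / B n ω) Filter.atTop (nhds (1 / β)) :=
          tendsto_const_nhds.div hBt hβ0.ne'
        simpa using ((Filter.tendsto_add_atTop_iff_nat 1).2 h1).sub h1
      have hA : Filter.Tendsto (fun n => A (n + 1) ω) Filter.atTop (nhds 0) :=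
        squeeze_zero (fun n => hA0 _ _) (fun n => flowEnergy_succ_le hl hζ0 hζpos hstep n ω
          (h0.trans_le (hbB (n + 1)))) hinv
      have hA' : Filter.Tendsto (fun n => A n ω) Filter.atTop (nhds 0) :=
        (Filter.tendsto_add_atTop_iff_nat 1).1 hA
      have hVt : Filter.Tendsto (fun n => V n ω) Filter.atTop (nhds β) := by
        have : Filter.Tendsto (fun n => B n ω / (1 + m * A n ω * B n ω)) Filter.atTop
            (nhds (β / (1 + m * 0 * β))) :=
          hBt.div (tendsto_const_nhds.add ((tendsto_const_nhds.mul hA').mul hBt)) (by simp)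
        simpa using this
      rw [(ENNReal.tendsto_ofReal hVt).liminf_eq]
      exact ENNReal.ofReal_le_ofReal hβ
    calc ∫⁻ ω, ENNReal.ofReal (b ω) ∂P
        ≤ ∫⁻ ω, Filter.liminf (fun n => ENNReal.ofReal (V n ω)) Filter.atTop ∂P :=
          lintegral_mono hlim
      _ ≤ Filter.liminf (fun n => ∫⁻ ω, ENNReal.ofReal (V n ω) ∂P) Filter.atTop :=
          lintegral_liminf_le fun n => (hVm n).ennreal_ofReal
      _ ≤ _ := Filter.liminf_le_of_le (by isBoundedDefault) fun x hx => by
          obtain ⟨n, hn⟩ := hx.exists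
          exact hn.trans (hintV n)
  -- let `m → ∞`
  have hE : Filter.Tendsto (fun m : ℕ => P {ω | 0 < b ω ∧ g ω < 1 / ((m : ℝ) + 1)}) Filter.atTop
      (nhds 0) := by
    have h1 := tendsto_measure_iInter_atTop (μ := P)
      (s := fun m : ℕ => {ω | 0 < b ω ∧ g ω < 1 / ((m : ℝ) + 1)})
      (fun m => (hSm.inter (measurableSet_lt hgm measurable_const)).nullMeasurableSet)
      (fun m n hmn ω hω => ⟨hω.1, hω.2.trans_le (Nat.one_div_le_one_div hmn)⟩)
      ⟨0, measure_ne_top _ _⟩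
    have h2 : P (⋂ m : ℕ, {ω | 0 < b ω ∧ g ω < 1 / ((m : ℝ) + 1)}) = 0 := by
      refine measure_eq_zero_iff_ae_notMem.2 ?_
      filter_upwards [hzero] with ω hω hmem
      have hmem' := Set.mem_iInter.1 hmem
      have hgω : g ω ≤ 0 := by
        refine ge_of_tendsto tendsto_one_div_add_atTop_nhds_zero_nat
          (Filter.Eventually.of_forall fun m => (hmem' m).2.le)
      have := hω (le_antisymm hgω (hg0 ω))
      have := (hmem' 0).1
      linarith
    rwa [h2] at h1
  have hlim : Filter.Tendsto (fun m : ℕ => ∫⁻ ω, ENNReal.ofReal (g ω) ∂P +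
      2 * (P {ω | 0 < b ω ∧ g ω < 1 / ((m : ℝ) + 1)} / P {ω | 0 < b ω})) Filter.atTop
      (nhds (∫⁻ ω, ENNReal.ofReal (g ω) ∂P + 2 * (0 / P {ω | 0 < b ω}))) :=
    tendsto_const_nhds.add (ENNReal.Tendsto.const_mul (ENNReal.Tendsto.div_const hE (Or.inr hP0))
      (Or.inr (by simp)))
  simpa using ge_of_tendsto' hlim hbound

/-! ### The offspring generating function -/

theorem hasSum_toReal (p : PMF ℕ) : HasSum (fun k => (p k).toReal) 1 := by
  have h := ENNReal.hasSum_toReal (f := fun k => p k) (by rw [p.tsum_coe]; simp)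
  rwa [← ENNReal.tsum_toReal_eq p.apply_ne_top, p.tsum_coe, ENNReal.toReal_one] at h

theorem summable_genFun (p : PMF ℕ) {x : ℝ} (hx0 : 0 ≤ x) (hx1 : x ≤ 1) :
    Summable fun k => (p k).toReal * x ^ k :=
  (hasSum_toReal p).summable.of_nonneg_of_le (fun k => by positivity)
    fun k => mul_le_of_le_one_right ENNReal.toReal_nonneg (pow_le_one₀ hx0 hx1)

theorem tsum_mul_pow_eq_ofReal_genFun (p : PMF ℕ) {x : ℝ} (hx0 : 0 ≤ x) (hx1 : x ≤ 1) :
    ∑' k, p k * ENNReal.ofReal x ^ k = ENNReal.ofReal (genFun p x) := by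
  rw [genFun, ENNReal.ofReal_tsum_of_nonneg (fun k => by positivity) (summable_genFun p hx0 hx1)]
  refine tsum_congr fun k => ?_
  rw [ENNReal.ofReal_mul ENNReal.toReal_nonneg, ENNReal.ofReal_toReal (p.apply_ne_top k),
    ENNReal.ofReal_pow hx0]

theorem genFun_monotoneOn (p : PMF ℕ) : MonotoneOn (genFun p) (Set.Icc 0 1) := by
  intro x hx y hy hxy
  refine (summable_genFun p hx.1 hx.2).tsum_le_tsum (fun k => ?_) (summable_genFun p hy.1 hy.2)
  have := pow_le_pow_left₀ hx.1 hxy k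
  gcongr

/-- Summing the geometric sums `1 + x + ⋯ + x ^ (k - 1)` gives the slope of `f` between `x`
and `1`. -/
theorem hasSum_slope (p : PMF ℕ) {x : ℝ} (hx0 : 0 ≤ x) (hx1 : x < 1) :
    HasSum (fun k => (p k).toReal * ∑ j ∈ Finset.range k, x ^ j)
      ((1 - genFun p x) / (1 - x)) := by
  have h1 : HasSum (fun k => (p k).toReal * x ^ k) (genFun p x) :=
    (summable_genFun p hx0 hx1.le).hasSum
  refine (((hasSum_toReal p).sub h1).div_const (1 - x)).congr_fun ?_
  intro k
  have : (1 : ℝ) - x ≠ 0 := by linarith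
  have h2 := mul_neg_geom_sum x k
  rw [eq_div_iff this, ← mul_one_sub, ← h2]
  ring

/-- If the mean exceeds `1`, then some individual has at least two children. -/
theorem exists_two_le_of_one_lt_mean {p : PMF ℕ} (hp : 1 < mean p) : ∃ k, 2 ≤ k ∧ p k ≠ 0 := by
  by_contra! h
  have : mean p ≤ 1 := by
    rw [mean, ← p.tsum_coe]
    refine ENNReal.tsum_le_tsum fun k => ?_
    rcases lt_or_ge k 2 with hk | hk
    · have : (k : ℝ≥0∞) ≤ 1 := by exact_mod_cast Nat.lt_succ_iff.1 hk
      exact mul_le_of_le_one_left' this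
    · simp [h k hk]
  exact absurd hp this.not_gt

/-- The generating function has at most one fixed point below `1`: otherwise its slopes between
that point and `1` would agree at two points, but they are strictly increasing. -/
theorem fixed_point_unique {p : PMF ℕ} (hp : 1 < mean p) {a r : ℝ} (ha0 : 0 ≤ a) (har : a ≤ r)
    (hr : r < 1) (hfa : genFun p a = a) (hfr : genFun p r = r) : a = r := by
  refine har.eq_of_not_lt fun hlt => ?_
  obtain ⟨m, hm2, hm⟩ := exists_two_le_of_one_lt_mean hp
  have h1 := hasSum_slope p ha0 (har.trans_lt hr)
  have h2 := hasSum_slope p (ha0.trans har) hr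
  rw [hfa, div_self (by linarith)] at h1
  rw [hfr, div_self (by linarith)] at h2
  have hpow : ∀ j : ℕ, a ^ j ≤ r ^ j := fun j => pow_le_pow_left₀ ha0 har j
  have hlt' : (1 : ℝ) < 1 := by
    refine hasSum_lt (i := m) (fun k => ?_) ?_ h1 h2
    · exact mul_le_mul_of_nonneg_left (Finset.sum_le_sum fun j _ => hpow j) ENNReal.toReal_nonneg
    · refine mul_lt_mul_of_pos_left ?_ (ENNReal.toReal_pos hm (p.apply_ne_top m))
      exact Finset.sum_lt_sum (fun j _ => hpow j) ⟨1, Finset.mem_range.2 (by omega), by simpa⟩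
  exact lt_irrefl _ hlt'

/-- A solution vanishes at a tree if and only if it vanishes at the subtrees of all children, so
the probability of this event is a fixed point of the generating function. -/
theorem measure_eq_zero_solution (p : PMF ℕ) {l : ℝ} (hl : 0 < l) {F : OffspringField → ℝ}
    (hFm : Measurable F) (hF0 : ∀ ω, 0 ≤ F ω)
    (hF : ∀ ω, F ω = childSum F ω / (l + childSum F ω)) :
    genFun p ((law p).real {ω | F ω = 0}) = (law p).real {ω | F ω = 0} := by
  have hm : MeasurableSet {ω | F ω = 0} := hFm (measurableSet_singleton 0)
  have hiff : ∀ ω, F ω = 0 ↔ ∀ i ∈ Finset.range (ω []), F (subfield ω i) = 0 := by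
    intro ω
    have hs := childSum_nonneg hF0 ω
    rw [← Finset.sum_eq_zero_iff_of_nonneg fun i _ => hF0 _, hF ω]
    change _ ↔ childSum F ω = 0
    constructor
    · intro h
      rcases div_eq_zero_iff.1 h with h | h
      · exact h
      · linarith
    · intro h; simp [h]
  have h := lintegral_prod_subfield p (f := {ω | F ω = 0}.indicator 1) (measurable_one.indicator hm)
  have hprod : ∀ ω : OffspringField, ∏ i ∈ Finset.range (ω []),
      {ω | F ω = 0}.indicator (1 : OffspringField → ℝ≥0∞) (subfield ω i) =
        {ω | F ω = 0}.indicator (1 : OffspringField → ℝ≥0∞) ω := by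
    intro ω
    by_cases hω : F ω = 0
    · rw [Set.indicator_of_mem (by exact hω)]
      refine Finset.prod_eq_one fun i hi => ?_
      rw [Set.indicator_of_mem (by exact (hiff ω).1 hω i hi)]; rfl
    · rw [Set.indicator_of_notMem (by exact hω)]
      have := mt (hiff ω).2 hω
      push Not at this
      obtain ⟨i, hi, hne⟩ := this
      exact Finset.prod_eq_zero hi (Set.indicator_of_notMem (by exact hne) _)
  rw [lintegral_congr hprod, lintegral_indicator_one hm] at h
  have hr : law p {ω | F ω = 0} = ENNReal.ofReal ((law p).real {ω | F ω = 0}) :=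
    (ofReal_measureReal (measure_ne_top _ _)).symm
  rw [hr, tsum_mul_pow_eq_ofReal_genFun p measureReal_nonneg measureReal_le_one] at h
  refine ((ENNReal.ofReal_eq_ofReal_iff measureReal_nonneg ?_).1 h).symm
  exact tsum_nonneg fun k => by positivity

theorem ae_eq_of_solution_of_one_lt_mean {p : PMF ℕ} (hp : 1 < mean p) {l : ℝ} (hl : 0 < l)
    {g b : OffspringField → ℝ}
    (hgm : Measurable g) (hbm : Measurable b) (hg0 : ∀ ω, 0 ≤ g ω) (hgb : ∀ ω, g ω ≤ b ω)
    (hb1 : ∀ ω, b ω ≤ 1) (hg : ∀ ω, g ω = childSum g ω / (l + childSum g ω))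
    (hb : ∀ ω, b ω = childSum b ω / (l + childSum b ω))
    (hpos : (law p).real {ω | g ω = 0} < 1) : g =ᵐ[law p] b := by
  have hb0 : ∀ ω, 0 ≤ b ω := fun ω => (hg0 ω).trans (hgb ω)
  refine ae_eq_of_solution p hl hgm hbm hg0 hgb hb1 hg hb ?_
  have hsub : {ω | b ω = 0} ⊆ {ω | g ω = 0} := fun ω (hω : b ω = 0) =>
    le_antisymm ((hgb ω).trans hω.le) (hg0 ω)
  have heq := fixed_point_unique hp measureReal_nonneg (measureReal_mono hsub) hpos
    (measure_eq_zero_solution p hl hbm hb0 hb) (measure_eq_zero_solution p hl hgm hg0 hg)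
  have hms : MeasurableSet {ω | b ω = 0} := hbm (measurableSet_singleton 0)
  have := ae_eq_of_subset_of_measure_ge hsub
    ((measureReal_eq_measureReal_iff).1 heq).ge hms.nullMeasurableSet (measure_ne_top _ _)
  filter_upwards [this] with ω hω h0
  exact (iff_of_eq hω).2 h0

open Filter Topology

/-! ### The limit of the escape probabilities of the cut trees -/

/-- The decreasing limit of the escape probabilities in the cut trees, which is the escape
probability by `escapeProb_eq`. -/
noncomputable def escapeLimit (l : ℝ) (ω : OffspringField) : ℝ :=
  ⨅ n, escapeIter l (fun _ => 1) n ω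

section escapeLimit

variable {l : ℝ}

theorem tendsto_escapeLimit (hl : 0 < l) (ω) :
    Tendsto (fun n => escapeIter l (fun _ => 1) n ω) atTop (𝓝 (escapeLimit l ω)) := by
  refine tendsto_atTop_ciInf (escapeIter_antitone hl (fun _ => zero_le_one) (fun ω => ?_) ω) ?_
  · exact escapeIter_le_one hl (fun _ => zero_le_one) (fun _ => le_rfl) 1 ω
  · exact ⟨0, by rintro _ ⟨n, rfl⟩; exact escapeIter_nonneg hl (fun _ => zero_le_one) n ω⟩

theorem escapeLimit_nonneg (hl : 0 < l) (ω) : 0 ≤ escapeLimit l ω :=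
  le_ciInf fun n => escapeIter_nonneg hl (fun _ => zero_le_one) n ω

theorem escapeLimit_le (hl : 0 < l) (n ω) :
    escapeLimit l ω ≤ escapeIter l (fun _ => 1) n ω :=
  ciInf_le ⟨0, by rintro _ ⟨n, rfl⟩; exact escapeIter_nonneg hl (fun _ => zero_le_one) n ω⟩ n

theorem escapeLimit_le_one (hl : 0 < l) (ω) : escapeLimit l ω ≤ 1 := escapeLimit_le hl 0 ω

theorem measurable_escapeLimit : Measurable (escapeLimit l) :=
  Measurable.iInf fun n => measurable_escapeIter measurable_const n

theorem tendsto_childSum {ι : Type*} {f : Filter ι} {F : ι → OffspringField → ℝ}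
    {G : OffspringField → ℝ} (h : ∀ ω, Tendsto (fun n => F n ω) f (𝓝 (G ω))) (ω) :
    Tendsto (fun n => childSum (F n) ω) f (𝓝 (childSum G ω)) :=
  tendsto_finsetSum _ fun _ _ => h _

theorem escapeLimit_eq (hl : 0 < l) (ω) :
    escapeLimit l ω = childSum (escapeLimit l) ω / (l + childSum (escapeLimit l) ω) := by
  have h1 := (tendsto_add_atTop_iff_nat 1).2 (tendsto_escapeLimit hl ω)
  have h2 := tendsto_childSum (tendsto_escapeLimit hl) ω
  have h0 := childSum_nonneg (escapeLimit_nonneg hl) ω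
  exact tendsto_nhds_unique h1 (h2.div (tendsto_const_nhds.add h2) (by positivity))

theorem escapeIter_anti_bias {l' : ℝ} (hl : 0 < l) (hll : l ≤ l') (n ω) :
    escapeIter l' (fun _ => 1) n ω ≤ escapeIter l (fun _ => 1) n ω := by
  induction n generalizing ω with
  | zero => exact le_rfl
  | succ n ih =>
    have hl' := hl.trans_le hll
    have h0 := childSum_nonneg (escapeIter_nonneg hl' (ζ := fun _ => 1) (fun _ => zero_le_one) n) ω
    refine (div_add_mono hl' h0 (childSum_mono ih ω)).trans ?_
    have := h0.trans (childSum_mono ih ω)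
    simp only [escapeIter]
    gcongr

theorem escapeLimit_anti {l' : ℝ} (hl : 0 < l) (hll : l ≤ l') (ω) :
    escapeLimit l' ω ≤ escapeLimit l ω :=
  le_ciInf fun n => (escapeLimit_le (hl.trans_le hll) n ω).trans (escapeIter_anti_bias hl hll n ω)

theorem continuousAt_escapeIter (hl : 0 < l) (n ω) :
    ContinuousAt (fun l => escapeIter l (fun _ => 1) n ω) l := by
  induction n generalizing ω with
  | zero => exact continuousAt_const
  | succ n ih =>
    have h := tendsto_childSum (F := fun l => escapeIter l (fun _ => 1) n) ih ω
    have h0 := childSum_nonneg (escapeIter_nonneg hl (ζ := fun _ => 1) (fun _ => zero_le_one) n) ω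
    exact h.div (tendsto_id.add h) (by positivity)

end escapeLimit

/-! ### Transience with positive probability -/

/-- Since the slope of the generating function at `1` is the mean, near `1` the function lies below
the line of any smaller slope through `(1, 1)`. -/
theorem exists_genFun_le {p : PMF ℕ} {m x₁ : ℝ} (hm : ENNReal.ofReal m < mean p) (hm0 : 0 ≤ m)
    (hx₁ : x₁ < 1) : ∃ x, 0 ≤ x ∧ x₁ ≤ x ∧ x < 1 ∧ genFun p x ≤ 1 - m * (1 - x) := by
  obtain ⟨s, hs⟩ : ∃ s : Finset ℕ, ENNReal.ofReal m < ∑ k ∈ s, (k : ℝ≥0∞) * p k := by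
    rw [mean, ENNReal.tsum_eq_iSup_sum] at hm
    exact lt_iSup_iff.1 hm
  have hs' : m < ∑ k ∈ s, (p k).toReal * k := by
    have h1 : ∑ k ∈ s, (k : ℝ≥0∞) * p k = ENNReal.ofReal (∑ k ∈ s, (p k).toReal * k) := by
      rw [ENNReal.ofReal_sum_of_nonneg fun k _ => by positivity]
      refine Finset.sum_congr rfl fun k _ => ?_
      rw [ENNReal.ofReal_mul ENNReal.toReal_nonneg, ENNReal.ofReal_toReal (p.apply_ne_top k),
        ENNReal.ofReal_natCast, mul_comm]
    rw [h1] at hs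
    exact (ENNReal.ofReal_lt_ofReal_iff_of_nonneg hm0).1 hs
  have hcont : Continuous fun x : ℝ => ∑ k ∈ s, (p k).toReal * ∑ j ∈ Finset.range k, x ^ j := by
    fun_prop
  have h1 : ∀ᶠ x in 𝓝[<] (1 : ℝ), m < ∑ k ∈ s, (p k).toReal * ∑ j ∈ Finset.range k, x ^ j :=
    (hcont.continuousAt.eventually_const_lt (by simpa using hs')).filter_mono nhdsWithin_le_nhds
  have h2 : ∀ᶠ x in 𝓝[<] (1 : ℝ), max 0 x₁ < x :=
    (eventually_gt_nhds (max_lt one_pos hx₁)).filter_mono nhdsWithin_le_nhds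
  obtain ⟨x, ⟨hx, hxm⟩, hx1⟩ := ((h1.and h2).and self_mem_nhdsWithin).exists
  have hx0 : 0 ≤ x := (le_max_left _ _).trans hxm.le
  refine ⟨x, hx0, (le_max_right _ _).trans hxm.le, hx1, ?_⟩
  have h3 : m ≤ (1 - genFun p x) / (1 - x) := by
    refine hx.le.trans (sum_le_hasSum s (fun k _ => ?_) (hasSum_slope p hx0 hx1))
    exact mul_nonneg ENNReal.toReal_nonneg (Finset.sum_nonneg fun j _ => pow_nonneg hx0 j)
  rw [le_div_iff₀ (by have : x < 1 := hx1; linarith)] at h3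
  linarith

/-- The inequality behind the recursion for the Laplace transform at `κ`. Its right-hand side is
affine in `exp (-(κ * s))`, which is a product over the children if `s` is a sum over the children. For
`s ≤ m - l` it follows from convexity of the exponential, for `s ≥ m - l` from the hypothesis on `κ`. -/
theorem exp_neg_mul_div_le {l m κ s : ℝ} (hl : 1 ≤ l) (hlm : l < m) (hκ : 0 ≤ κ) (hs : 0 ≤ s)
    (hκm : Real.exp (-(κ * ((m - l) / m))) ≤ 1 - 1 / m) :
    Real.exp (-(κ * (s / (l + s)))) ≤ (1 - 1 / m) + 1 / m * Real.exp (-(κ * s)) := by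
  have hm0 : 0 < m := by linarith
  rcases le_total s (m - l) with h | h
  · have hθ0 : 0 ≤ 1 / (l + s) := by positivity
    have hθ1 : 1 / (l + s) ≤ 1 := by rw [div_le_one (by positivity)]; linarith
    have hconv := convexOn_exp.2 (Set.mem_univ 0) (Set.mem_univ (-(κ * s)))
      (sub_nonneg.2 hθ1) hθ0 (by ring)
    simp only [smul_eq_mul, mul_zero, zero_add, Real.exp_zero, mul_one] at hconv
    have e : -(κ * (s / (l + s))) = 1 / (l + s) * -(κ * s) := by ring
    rw [e]
    refine hconv.trans ?_
    have h1 : Real.exp (-(κ * s)) ≤ 1 := Real.exp_le_one_iff.2 (by have := mul_nonneg hκ hs; linarith)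
    have h2 : 1 / m ≤ 1 / (l + s) := one_div_le_one_div_of_le (by positivity) (by linarith)
    nlinarith
  · have h1 : (m - l) / m ≤ s / (l + s) := by
      have := div_add_mono (l := l) (by linarith) (sub_nonneg.2 hlm.le) h
      simpa using this
    have h2 : Real.exp (-(κ * (s / (l + s)))) ≤ Real.exp (-(κ * ((m - l) / m))) := by
      gcongr
    have : 0 ≤ 1 / m * Real.exp (-(κ * s)) := by positivity
    linarith

/-- The walk is transient with positive probability if the bias is less than the mean. The Laplace
transform `x_n` at `κ` of the escape probability in the tree cut at generation `n` satisfies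
`x_{n+1} ≤ 1 - 1 / m + f (x_n) / m`, so it stays below a point `x < 1` with
`f x ≤ 1 - m * (1 - x)`. -/
theorem measure_escapeLimit_eq_zero_lt_one_of_one_le {p : PMF ℕ} {l m : ℝ} (hl : 1 ≤ l) (hlm : l < m)
    (hm : ENNReal.ofReal m < mean p) : (law p).real {ω | escapeLimit l ω = 0} < 1 := by
  have hl0 : 0 < l := by linarith
  have hm0 : 0 < m := by linarith
  have hm1 : 0 < 1 - 1 / m := by
    rw [sub_pos, div_lt_one hm0]; linarith
  obtain ⟨κ, hκ0, hκ⟩ : ∃ κ : ℝ, 0 < κ ∧ Real.exp (-(κ * ((m - l) / m))) ≤ 1 - 1 / m := by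
    have hpos : 0 < (m - l) / m := div_pos (by linarith) hm0
    have ht : Tendsto (fun κ : ℝ => Real.exp (-(κ * ((m - l) / m)))) atTop (𝓝 0) :=
      Real.tendsto_exp_neg_atTop_nhds_zero.comp (tendsto_id.atTop_mul_const hpos)
    obtain ⟨κ, h1, h2⟩ := ((ht.eventually_le_const hm1).and (eventually_gt_atTop 0)).exists
    exact ⟨κ, h2, h1⟩
  obtain ⟨x, hx0, hx₁, hx1, hx⟩ := exists_genFun_le (x₁ := Real.exp (-κ)) hm hm0.le
    (by simpa using hκ0)
  set B : ℕ → OffspringField → ℝ := escapeIter l (fun _ => 1) with hBdef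
  have hBm : ∀ n, Measurable (B n) := measurable_escapeIter measurable_const
  have hB0 : ∀ n ω, 0 ≤ B n ω := escapeIter_nonneg hl0 (fun _ => zero_le_one)
  have hE : ∀ n, Measurable fun ω => ENNReal.ofReal (Real.exp (-(κ * B n ω))) := fun n =>
    (((hBm n).const_mul κ).neg.exp).ennreal_ofReal
  have hind : ∀ n, ∫⁻ ω, ENNReal.ofReal (Real.exp (-(κ * B n ω))) ∂(law p) ≤ ENNReal.ofReal x := by
    intro n
    induction n with
    | zero => simpa [hBdef, escapeIter] using ENNReal.ofReal_le_ofReal hx₁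
    | succ n ih =>
      have h1 : ∀ ω, ENNReal.ofReal (Real.exp (-(κ * B (n + 1) ω))) ≤
          ENNReal.ofReal (1 - 1 / m) + ENNReal.ofReal (1 / m) *
            ∏ i ∈ Finset.range (ω []),
              ENNReal.ofReal (Real.exp (-(κ * B n (subfield ω i)))) := by
        intro ω
        rw [← ENNReal.ofReal_prod_of_nonneg fun i _ => (Real.exp_pos _).le,
          ← Real.exp_sum, Finset.sum_neg_distrib, ← Finset.mul_sum,
          ← ENNReal.ofReal_mul (by positivity),
          ← ENNReal.ofReal_add hm1.le (by positivity)]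
        exact ENNReal.ofReal_le_ofReal
          (exp_neg_mul_div_le hl hlm hκ0.le (childSum_nonneg (hB0 n) ω) hκ)
      have hprodm : Measurable fun ω : OffspringField => ∏ i ∈ Finset.range (ω []),
              ENNReal.ofReal (Real.exp (-(κ * B n (subfield ω i)))) := by
        have : Measurable (Function.uncurry fun (k : ℕ) (η : ℕ → OffspringField) =>
            ∏ i ∈ Finset.range k, ENNReal.ofReal (Real.exp (-(κ * B n (η i))))) :=
          measurable_from_prod_countable_right fun k => by
            change Measurable fun η : ℕ → OffspringField =>
              ∏ i ∈ Finset.range k, ENNReal.ofReal (Real.exp (-(κ * B n (η i))))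
            exact Finset.measurable_prod _ fun i _ => (hE n).comp (measurable_pi_apply i)
        exact this.comp ((measurable_pi_apply []).prodMk measurable_subfield)
      calc ∫⁻ ω, ENNReal.ofReal (Real.exp (-(κ * B (n + 1) ω))) ∂(law p)
          ≤ ∫⁻ ω, (ENNReal.ofReal (1 - 1 / m) + ENNReal.ofReal (1 / m) *
            ∏ i ∈ Finset.range (ω []),
              ENNReal.ofReal (Real.exp (-(κ * B n (subfield ω i))))) ∂(law p) :=
            lintegral_mono h1
        _ = ENNReal.ofReal (1 - 1 / m) + ENNReal.ofReal (1 / m) *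
            ∑' k, p k * (∫⁻ ω, ENNReal.ofReal (Real.exp (-(κ * B n ω))) ∂(law p)) ^ k := by
            rw [lintegral_add_left measurable_const, lintegral_const_mul _ hprodm,
              lintegral_prod_subfield p (hE n)]
            simp
        _ ≤ ENNReal.ofReal (1 - 1 / m) + ENNReal.ofReal (1 / m) *
            ∑' k, p k * ENNReal.ofReal x ^ k := by gcongr
        _ = ENNReal.ofReal ((1 - 1 / m) + 1 / m * genFun p x) := by
            have hg : 0 ≤ genFun p x := tsum_nonneg fun k => by positivity
            rw [tsum_mul_pow_eq_ofReal_genFun p hx0 hx1.le, ← ENNReal.ofReal_mul (by positivity),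
              ← ENNReal.ofReal_add hm1.le (by positivity)]
        _ ≤ ENNReal.ofReal x := by
            refine ENNReal.ofReal_le_ofReal ?_
            have : 1 / m * genFun p x ≤ 1 / m * (1 - m * (1 - x)) := by gcongr
            have e : 1 / m * (1 - m * (1 - x)) = 1 / m - (1 - x) := by field_simp
            linarith
  have hzero : law p {ω | escapeLimit l ω = 0} ≤ ENNReal.ofReal x := by
    have hms : MeasurableSet {ω | escapeLimit l ω = 0} :=
      measurable_escapeLimit (measurableSet_singleton 0)
    calc law p {ω | escapeLimit l ω = 0}
        = ∫⁻ ω, {ω | escapeLimit l ω = 0}.indicator 1 ω ∂(law p) := (lintegral_indicator_one hms).symm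
      _ ≤ ∫⁻ ω, liminf (fun n => ENNReal.ofReal (Real.exp (-(κ * B n ω)))) atTop ∂(law p) := by
          refine lintegral_mono fun ω => ?_
          have ht : Tendsto (fun n => ENNReal.ofReal (Real.exp (-(κ * B n ω)))) atTop
              (𝓝 (ENNReal.ofReal (Real.exp (-(κ * escapeLimit l ω))))) :=
            ENNReal.tendsto_ofReal ((Real.continuous_exp.tendsto _).comp
              ((tendsto_escapeLimit hl0 ω).const_mul κ).neg)
          rw [ht.liminf_eq]
          by_cases hω : escapeLimit l ω = 0
          · rw [Set.indicator_of_mem (by exact hω), hω]; simp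
          · rw [Set.indicator_of_notMem (by exact hω)]; simp
      _ ≤ liminf (fun n => ∫⁻ ω, ENNReal.ofReal (Real.exp (-(κ * B n ω))) ∂(law p)) atTop :=
          lintegral_liminf_le hE
      _ ≤ ENNReal.ofReal x := liminf_le_of_le (by isBoundedDefault) fun y hy => by
          obtain ⟨n, hn⟩ := hy.exists
          exact hn.trans (hind n)
  have := ENNReal.toReal_mono ENNReal.ofReal_ne_top hzero
  rw [ENNReal.toReal_ofReal hx0] at this
  exact this.trans_lt hx1

theorem measure_escapeLimit_eq_zero_lt_one {p : PMF ℕ} (hp : 1 < mean p) {l : ℝ} (hl : 0 < l)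
    (hlp : ENNReal.ofReal l < mean p) : (law p).real {ω | escapeLimit l ω = 0} < 1 := by
  have h1 : ENNReal.ofReal (max 1 l) < mean p := by
    rw [ENNReal.ofReal_max, ENNReal.ofReal_one]; exact max_lt hp hlp
  obtain ⟨m, hm1, hm2⟩ := ENNReal.lt_iff_exists_nnreal_btwn.1 h1
  have hlt : max 1 l < m := by
    rw [ENNReal.ofReal_lt_coe_iff (by positivity)] at hm1; exact hm1
  have := measure_escapeLimit_eq_zero_lt_one_of_one_le (p := p) (le_max_left 1 l) hlt (by simpa using hm2)
  refine lt_of_le_of_lt (measureReal_mono fun ω hω => ?_) this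
  exact le_antisymm ((escapeLimit_anti hl (le_max_right 1 l) ω).trans (le_of_eq hω))
    (escapeLimit_nonneg (by positivity) ω)

/-! ### Continuity in the bias at almost every tree -/

/-- At almost every tree the escape probability is continuous in the bias. It is decreasing and
a decreasing limit of continuous functions, hence left-continuous; its right limit is a solution of
the recursion as well, and positive with positive probability. -/
theorem ae_continuousAt_escapeLimit {p : PMF ℕ} (hp : 1 < mean p) {l : ℝ} (hl : 0 < l)
    (hlp : ENNReal.ofReal l < mean p) :
    ∀ᵐ ω ∂(law p), ContinuousAt (fun l => escapeLimit l ω) l := by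
  let u : ℕ → ℝ := fun j => l + 1 / ((j : ℝ) + 1)
  have hul : ∀ j, l < u j := fun j => lt_add_of_pos_right l (by positivity)
  have hu0 : ∀ j, 0 < u j := fun j => hl.trans (hul j)
  have hut : Tendsto u atTop (𝓝 l) := by
    simpa [u] using (tendsto_const_nhds (x := l)).add tendsto_one_div_add_atTop_nhds_zero_nat
  have huanti : Antitone u := fun i j hij =>
    add_le_add_right (Nat.one_div_le_one_div hij) l
  -- the right limit of the escape probability
  let g : OffspringField → ℝ := fun ω => ⨆ j, escapeLimit (u j) ω
  have hle : ∀ j ω, escapeLimit (u j) ω ≤ escapeLimit l ω := fun j ω =>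
    escapeLimit_anti hl (hul j).le ω
  have hbdd : ∀ ω, BddAbove (Set.range fun j => escapeLimit (u j) ω) := fun ω =>
    ⟨escapeLimit l ω, by rintro _ ⟨j, rfl⟩; exact hle j ω⟩
  have hgt : ∀ ω, Tendsto (fun j => escapeLimit (u j) ω) atTop (𝓝 (g ω)) := fun ω =>
    tendsto_atTop_ciSup (fun i j hij => escapeLimit_anti (hu0 j) (huanti hij) ω) (hbdd ω)
  have hgm : Measurable g := Measurable.iSup fun j => measurable_escapeLimit
  have hg0 : ∀ ω, 0 ≤ g ω := fun ω =>
    (escapeLimit_nonneg (hu0 0) ω).trans (le_ciSup (hbdd ω) 0)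
  have hgsol : ∀ ω, g ω = childSum g ω / (l + childSum g ω) := by
    intro ω
    have h1 := hgt ω
    have h2 := tendsto_childSum hgt ω
    have h0 := childSum_nonneg hg0 ω
    refine tendsto_nhds_unique h1 ?_
    simp_rw [fun j => escapeLimit_eq (hu0 j) ω]
    exact h2.div (hut.add h2) (by positivity)
  obtain ⟨j, hj⟩ : ∃ j, ENNReal.ofReal (u j) < mean p :=
    ((ENNReal.tendsto_ofReal hut).eventually_lt_const hlp).exists
  have hpos : (law p).real {ω | g ω = 0} < 1 := by
    refine lt_of_le_of_lt (measureReal_mono fun ω hω => ?_)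
      (measure_escapeLimit_eq_zero_lt_one hp (hu0 j) hj)
    exact le_antisymm ((le_ciSup (hbdd ω) j).trans (le_of_eq hω)) (escapeLimit_nonneg (hu0 j) ω)
  have hgb := ae_eq_of_solution_of_one_lt_mean hp hl hgm measurable_escapeLimit hg0
    (fun ω => ciSup_le fun j => hle j ω) (escapeLimit_le_one hl) hgsol (escapeLimit_eq hl) hpos
  filter_upwards [hgb] with ω hω
  refine tendsto_order.2 ⟨fun a ha => ?_, fun a ha => ?_⟩
  · change a < escapeLimit l ω at ha
    rw [← hω] at ha
    obtain ⟨j, hj⟩ := exists_lt_of_lt_ciSup ha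
    filter_upwards [Ioo_mem_nhds hl (hul j)] with x hx
    exact hj.trans_le (escapeLimit_anti hx.1 hx.2.le ω)
  · obtain ⟨n, hn⟩ := exists_lt_of_ciInf_lt ha
    filter_upwards [(continuousAt_escapeIter hl n ω).eventually_lt_const hn, lt_mem_nhds hl]
      with x hx hx0
    exact (escapeLimit_le hx0 n ω).trans_lt hx

/-! ### Survival and the critical bias -/

/-- A tree with no individual in generation `n` cannot be escaped from. -/
theorem exists_vertex_of_escapeIter_pos {l : ℝ} (n : ℕ) (ω : OffspringField)
    (h : escapeIter l (fun _ => 1) n ω ≠ 0) : ∃ x, IsVertex ω x ∧ x.length = n := by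
  induction n generalizing ω with
  | zero => exact ⟨[], trivial, rfl⟩
  | succ n ih =>
    have hs : childSum (escapeIter l (fun _ => 1) n) ω ≠ 0 := fun h0 => h (by simp [escapeIter, h0])
    obtain ⟨i, hi, hne⟩ := Finset.exists_ne_zero_of_sum_ne_zero hs
    obtain ⟨x, hx, hxn⟩ := ih _ hne
    refine ⟨x ++ [i], ?_, by simp [hxn]⟩
    clear hne hs h ih hxn
    induction x with
    | nil => exact ⟨trivial, Finset.mem_range.1 hi⟩
    | cons j y ihy => exact ⟨ihy hx.1, hx.2⟩

theorem finite_generation (ω : OffspringField) (n : ℕ) :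
    {x : List ℕ | IsVertex ω x ∧ x.length = n}.Finite := by
  induction n with
  | zero =>
    refine (Set.finite_singleton []).subset fun x hx => ?_
    simpa using hx.2
  | succ n ih =>
    refine (ih.biUnion fun x _ => (Set.finite_Iio (ω x)).image (fun i => i :: x)).subset ?_
    rintro x ⟨hx, hxn⟩
    cases x with
    | nil => simp at hxn
    | cons i y =>
      exact Set.mem_biUnion (x := y) ⟨hx.1, by simpa using hxn⟩ ⟨i, hx.2, rfl⟩

theorem survival_of_escapeLimit_ne_zero {l : ℝ} (hl : 0 < l) {ω : OffspringField}
    (h : escapeLimit l ω ≠ 0) : ω ∈ survival := by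
  intro n hn
  have hpos : 0 < escapeIter l (fun _ => 1) n ω :=
    ((escapeLimit_nonneg hl ω).lt_of_ne' h).trans_le (escapeLimit_le hl n ω)
  obtain ⟨x, hx⟩ := exists_vertex_of_escapeIter_pos n ω hpos.ne'
  rw [genSize, Set.ncard_eq_zero (finite_generation ω n)] at hn
  exact (hn ▸ hx : x ∈ (∅ : Set (List ℕ)))

theorem extinctionProb_lt_one {p : PMF ℕ} (hp : 1 < mean p) : extinctionProb p < 1 := by
  refine lt_of_le_of_lt (measureReal_mono fun ω hω => ?_)
    (measure_escapeLimit_eq_zero_lt_one hp one_pos (by simpa using hp))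
  by_contra h
  exact hω (survival_of_escapeLimit_ne_zero one_pos h)

/-- Below `1` the generating function is increasing, and `q < 1`. -/
theorem criticalBias_nonneg {p : PMF ℕ} (hp : 1 < mean p) : 0 ≤ criticalBias p := by
  rw [criticalBias]
  split_ifs with h0
  · exact le_rfl
  set q := extinctionProb p
  have hq1 : q < 1 := extinctionProb_lt_one hp
  have hq0 : 0 ≤ q := measureReal_nonneg
  by_cases hd : DifferentiableAt ℝ (genFun p) q
  · have h1 := (hasDerivWithinAt_iff_tendsto_slope' (s := Set.Ioi q) (by simp)).1
      hd.hasDerivAt.hasDerivWithinAt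
    refine ge_of_tendsto h1 ?_
    filter_upwards [Ioo_mem_nhdsGT hq1] with x hx
    rw [slope_def_field]
    refine div_nonneg (sub_nonneg.2 ?_) (sub_nonneg.2 hx.1.le)
    exact genFun_monotoneOn p ⟨hq0, hq1.le⟩ ⟨hq0.trans hx.1.le, hx.2.le⟩ hx.1.le
  · rw [deriv_zero_of_not_differentiableAt hd]

end GaltonWatson

/-! ### The killed walk on a rooted tree -/

namespace LocFinRootedTree

variable {V : Type*}

theorem numChildren_eq_card (T : LocFinRootedTree V) (x : V) :
    T.numChildren x = (T.finite_children x).toFinset.card := by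
  rw [numChildren, Set.ncard_eq_toFinset_card _ (T.finite_children x)]

theorem parent_ne_of_parent_eq (T : LocFinRootedTree V) {x y : V} (h : T.parent x = some y) :
    T.parent y ≠ some x := fun h' =>
  (T.wellFounded.asymmetric (r := fun x y => T.parent y = some x)) y x h h'

variable [MeasurableSpace V] [DiscreteMeasurableSpace V]

theorem lintegral_stepKernel [Countable V] (T : LocFinRootedTree V) {l : ℝ} (hl : 0 < l)
    (hroot : T.numChildren T.root ≠ 0) (x : V) (g : V → ℝ≥0∞) :
    ∫⁻ z, g z ∂(T.stepKernel l x) = ∑' z, ENNReal.ofReal (T.trans l x z) * g z := by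
  change ∫⁻ z, g z ∂(T.stepPMF l x).toMeasure = _
  rw [lintegral_countable']
  refine tsum_congr fun z => ?_
  rw [PMF.toMeasure_apply_singleton _ _ (measurableSet_singleton z), T.stepPMF_apply hl hroot,
    mul_comm]

theorem lintegral_stepKernel_root [Countable V] (T : LocFinRootedTree V) {l : ℝ} (hl : 0 < l)
    (hroot : T.numChildren T.root ≠ 0) (g : V → ℝ≥0∞) :
    ∫⁻ z, g z ∂(T.stepKernel l T.root) = ∑ z ∈ (T.finite_children T.root).toFinset,
      ENNReal.ofReal (1 / T.numChildren T.root) * g z := by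
  have hp : T.parent T.root = none := (T.parent_eq_none_iff _).2 rfl
  rw [T.lintegral_stepKernel hl hroot, tsum_eq_sum (s := (T.finite_children T.root).toFinset)]
  · refine Finset.sum_congr rfl fun z hz => ?_
    have hz' : T.parent z = some T.root := by simpa using hz
    simp [trans, hp, hz']
  · intro z hz
    have hz' : T.parent z ≠ some T.root := by simpa using hz
    simp [trans, hp, hz']

theorem lintegral_stepKernel_of_parent [Countable V] (T : LocFinRootedTree V) {l : ℝ} (hl : 0 < l)
    (hroot : T.numChildren T.root ≠ 0) {x w : V} (hx : T.parent x = some w) (g : V → ℝ≥0∞) :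
    ∫⁻ z, g z ∂(T.stepKernel l x) = ENNReal.ofReal (l / (l + T.numChildren x)) * g w +
      ∑ z ∈ (T.finite_children x).toFinset, ENNReal.ofReal (1 / (l + T.numChildren x)) * g z := by
  classical
  have hxr : x ≠ T.root := fun h => by
    rw [(T.parent_eq_none_iff x).2 h] at hx; simp at hx
  have hw : w ∉ (T.finite_children x).toFinset := by
    simpa using T.parent_ne_of_parent_eq hx
  rw [T.lintegral_stepKernel hl hroot, tsum_eq_sum (s := insert w (T.finite_children x).toFinset),
    Finset.sum_insert hw]
  · congr 1
    · simp [trans, hx]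
    · refine Finset.sum_congr rfl fun z hz => ?_
      have hz' : T.parent z = some x := by simpa using hz
      have hwz : w ≠ z := fun h => hw (h ▸ hz)
      simp [trans, hx, hz', hwz, hxr]
  · intro z hz
    rw [Finset.mem_insert, not_or] at hz
    have hz' : T.parent z ≠ some x := by simpa using hz.2
    simp [trans, hx, hz', Ne.symm hz.1]

/-- The transition operator of the walk killed when it leaves `A`. -/
noncomputable def killedStep (T : LocFinRootedTree V) (l : ℝ) (A : Set V) (f : V → ℝ≥0∞) (x : V) :
    ℝ≥0∞ :=
  ∫⁻ z, A.indicator f z ∂(T.stepKernel l x)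

theorem map_eval_zero_walkLawFrom (T : LocFinRootedTree V) (l : ℝ) (x : V) :
    (T.walkLawFrom l x).map (fun Z => Z 0) = Measure.dirac x := by
  have h : (T.walkLawFrom l x).map (Preorder.frestrictLe 0) =
      (Measure.dirac x).map (MeasurableEquiv.piUnique (fun _ : Finset.Iic 0 => V)).symm := by
    rw [walkLawFrom, Kernel.trajMeasure, Measure.map_comp _ _ (by fun_prop),
      Kernel.traj_map_frestrictLe, Kernel.partialTraj_self, Measure.id_comp]
  have h2 : (fun Z : ℕ → V => Z 0) =
      (fun z : (i : Finset.Iic 0) → V => z ⟨0, by simp⟩) ∘ Preorder.frestrictLe 0 := rfl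
  rw [h2, ← Measure.map_map (measurable_pi_apply _) (by fun_prop), h,
    Measure.map_map (measurable_pi_apply _) (by fun_prop), Measure.map_dirac]
  rfl

/-- The expectation of `f (Z m)` on the event that the walk stays in `A` at the times `1, …, m` is
a power of the transition operator of the killed walk. -/
theorem setLIntegral_walkLawFrom (T : LocFinRootedTree V) (l : ℝ) (x : V) (A : Set V) (m : ℕ)
    (f : V → ℝ≥0∞) :
    ∫⁻ Z in {Z : ℕ → V | ∀ j, 1 ≤ j → j ≤ m → Z j ∈ A}, f (Z m) ∂(T.walkLawFrom l x) =
      (T.killedStep l A)^[m] f x := by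
  induction m generalizing f with
  | zero =>
    have : {Z : ℕ → V | ∀ j, 1 ≤ j → j ≤ 0 → Z j ∈ A} = Set.univ := by
      ext Z; simp; intro j h1 h2; omega
    rw [this, Measure.restrict_univ]
    have h := lintegral_map (μ := T.walkLawFrom l x) (f := f) (g := fun Z : ℕ → V => Z 0)
      Measurable.of_discrete (measurable_pi_apply 0)
    rw [map_eval_zero_walkLawFrom, lintegral_dirac] at h
    simpa using h.symm
  | succ m ih =>
    rw [Function.iterate_succ_apply, ← ih]
    set κ : (n : ℕ) → Kernel ((i : Finset.Iic n) → V) V := fun n => (T.stepKernel l).comap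
      (fun z : (i : Finset.Iic n) → V => z ⟨n, Finset.mem_Iic.2 le_rfl⟩) (measurable_pi_apply _)
      with hκ
    have hcp : (T.walkLawFrom l x).map (Preorder.frestrictLe m) ⊗ₘ κ m =
        (T.walkLawFrom l x).map (fun Z => (Preorder.frestrictLe m Z, Z (m + 1))) :=
      Kernel.map_frestrictLe_trajMeasure_compProd_eq_map_trajMeasure
    have hA : MeasurableSet A := .of_discrete
    have hf : Measurable f := .of_discrete
    have hS : ∀ n, MeasurableSet {Z : ℕ → V | ∀ j, 1 ≤ j → j ≤ n → Z j ∈ A} := fun n => by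
      simp only [Set.ofPred_forall]
      exact .iInter fun j => .iInter fun _ => .iInter fun _ => measurable_pi_apply j hA
    let S : Set ((i : Finset.Iic m) → V) := {z | ∀ j (hj : j ≤ m), 1 ≤ j →
      z ⟨j, Finset.mem_Iic.2 hj⟩ ∈ A}
    have hSm : MeasurableSet S := by
      simp only [S, Set.ofPred_forall]
      exact .iInter fun j => .iInter fun _ => .iInter fun _ => measurable_pi_apply _ hA
    have hAf : Measurable (A.indicator f) := hf.indicator hA
    have hG : Measurable fun q : ((i : Finset.Iic m) → V) × V =>
        S.indicator 1 q.1 * A.indicator f q.2 :=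
      ((measurable_one.indicator hSm).comp measurable_fst).mul (hAf.comp measurable_snd)
    have hker : Measurable (T.killedStep l A f) := .of_discrete
    calc ∫⁻ Z in {Z : ℕ → V | ∀ j, 1 ≤ j → j ≤ m + 1 → Z j ∈ A}, f (Z (m + 1))
            ∂(T.walkLawFrom l x)
        = ∫⁻ Z, S.indicator 1 (Preorder.frestrictLe m Z) * A.indicator f (Z (m + 1))
            ∂(T.walkLawFrom l x) := by
          rw [← lintegral_indicator (hS _)]
          refine lintegral_congr fun Z => ?_
          have hiff : Z ∈ {Z : ℕ → V | ∀ j, 1 ≤ j → j ≤ m + 1 → Z j ∈ A} ↔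
              (Preorder.frestrictLe m Z : (i : Finset.Iic m) → V) ∈ S ∧ Z (m + 1) ∈ A := by
            constructor
            · intro h
              exact ⟨fun j hj h1 => h j h1 (by omega), h (m + 1) (by omega) le_rfl⟩
            · rintro ⟨h1, h2⟩ j hj1 hjm
              rcases Nat.le_succ_iff.1 hjm with h | h
              · exact h1 j h hj1
              · rw [h]; exact h2
          by_cases h1 : (Preorder.frestrictLe m Z : (i : Finset.Iic m) → V) ∈ S
          · by_cases h2 : Z (m + 1) ∈ A
            · rw [Set.indicator_of_mem (hiff.2 ⟨h1, h2⟩), Set.indicator_of_mem h1,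
                Set.indicator_of_mem h2]
              simp
            · rw [Set.indicator_of_notMem (fun h => h2 (hiff.1 h).2),
                Set.indicator_of_notMem h2, mul_zero]
          · rw [Set.indicator_of_notMem (fun h => h1 (hiff.1 h).1),
                Set.indicator_of_notMem h1, zero_mul]
      _ = ∫⁻ q, S.indicator 1 q.1 * A.indicator f q.2
            ∂((T.walkLawFrom l x).map (fun Z => (Preorder.frestrictLe m Z, Z (m + 1)))) := by
          rw [lintegral_map hG (by fun_prop)]
      _ = ∫⁻ z, S.indicator 1 z * T.killedStep l A f (z ⟨m, Finset.mem_Iic.2 le_rfl⟩)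
            ∂((T.walkLawFrom l x).map (Preorder.frestrictLe m)) := by
          have : IsProbabilityMeasure (T.walkLawFrom l x) := by
            unfold walkLawFrom; infer_instance
          rw [← hcp, Measure.lintegral_compProd hG]
          refine lintegral_congr fun z => ?_
          change ∫⁻ b, S.indicator 1 z * A.indicator f b ∂(κ m z) =
            S.indicator 1 z * ∫⁻ b, A.indicator f b ∂(κ m z)
          rw [lintegral_const_mul _ hAf]
      _ = ∫⁻ Z in {Z : ℕ → V | ∀ j, 1 ≤ j → j ≤ m → Z j ∈ A}, T.killedStep l A f (Z m)
            ∂(T.walkLawFrom l x) := by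
          have hG' : Measurable fun z : (i : Finset.Iic m) → V =>
              S.indicator 1 z * T.killedStep l A f (z ⟨m, Finset.mem_Iic.2 le_rfl⟩) :=
            (measurable_one.indicator hSm).mul (hker.comp (measurable_pi_apply _))
          rw [lintegral_map hG' (by fun_prop), ← lintegral_indicator (hS _)]
          refine lintegral_congr fun Z => ?_
          have hiff : Z ∈ {Z : ℕ → V | ∀ j, 1 ≤ j → j ≤ m → Z j ∈ A} ↔
              (Preorder.frestrictLe m Z : (i : Finset.Iic m) → V) ∈ S :=
            ⟨fun h j hj h1 => h j h1 hj, fun h j h1 hj => h j hj h1⟩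
          by_cases h1 : (Preorder.frestrictLe m Z : (i : Finset.Iic m) → V) ∈ S
          · rw [Set.indicator_of_mem (hiff.2 h1), Set.indicator_of_mem h1]
            simp
          · rw [Set.indicator_of_notMem (fun h => h1 (hiff.1 h)),
                Set.indicator_of_notMem h1, zero_mul]

end LocFinRootedTree

theorem returnTime_eq_top_iff {V : Type*} (x : V) (Z : ℕ → V) :
    returnTime x Z = ⊤ ↔ ∀ n, 1 ≤ n → Z n ≠ x := by
  rw [returnTime, sInf_eq_top]
  constructor
  · intro h n hn hx
    exact ENat.natCast_ne_top n (h n ⟨n, ⟨hn, hx⟩, rfl⟩)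
  · rintro h _ ⟨n, ⟨hn, hx⟩, rfl⟩
    exact absurd hx (h n hn)

/-! ### Identification of the escape probability -/

namespace GaltonWatson

open Filter Topology

/-- The offspring field seen from the individual `x`. -/
def descend (ω : OffspringField) (x : List ℕ) : OffspringField := fun y => ω (y ++ x)

theorem subfield_descend (ω : OffspringField) (x : List ℕ) (i : ℕ) :
    subfield (descend ω x) i = descend ω (i :: x) := by
  ext y; simp [subfield, descend]

theorem descend_nil (ω : OffspringField) : descend ω [] = ω := by
  ext y; simp [descend]

theorem childSum_descend (F : OffspringField → ℝ) (ω : OffspringField) (x : List ℕ) :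
    childSum F (descend ω x) = ∑ i ∈ Finset.range (ω x), F (descend ω (i :: x)) := by
  simp only [childSum, subfield_descend]
  simp [descend]

/-- The value of `f` at the parent of a word, with the value `c` at the added root `e^*`. -/
def parentValue (c : ℝ) (f : List ℕ → ℝ) : List ℕ → ℝ
  | [] => c
  | _ :: x => f x

/-- `avoid l ω m x` is the probability that the walk on the tree with `e^*` added, started at the
individual `x`, does not hit `e^*` within `m` steps. It is defined for all words, so that no proof of
`IsVertex` has to be carried along. -/
noncomputable def avoid (l : ℝ) (ω : OffspringField) : ℕ → List ℕ → ℝ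
  | 0 => fun _ => 1
  | m + 1 => fun x => (l * parentValue 0 (avoid l ω m) x +
      ∑ i ∈ Finset.range (ω x), avoid l ω m (i :: x)) / (l + ω x)

/-- The product of `1 - escapeLimit` over the subtrees at `x` and all its ancestors. It bounds the
probability of hitting `e^*` from `x`: every ancestor has to be left upwards. -/
noncomputable def returnProd (l : ℝ) (ω : OffspringField) : List ℕ → ℝ
  | [] => 1 - escapeLimit l (descend ω [])
  | i :: x => (1 - escapeLimit l (descend ω (i :: x))) * returnProd l ω x

theorem avoid_nonneg {l : ℝ} (hl : 0 < l) (ω : OffspringField) (m x) : 0 ≤ avoid l ω m x := by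
  induction m generalizing x with
  | zero => exact zero_le_one
  | succ m ih =>
    have h1 : 0 ≤ parentValue 0 (avoid l ω m) x := by
      cases x with
      | nil => exact le_rfl
      | cons i x => exact ih x
    have h2 : 0 ≤ ∑ i ∈ Finset.range (ω x), avoid l ω m (i :: x) :=
      Finset.sum_nonneg fun i _ => ih _
    simp only [avoid]
    positivity

theorem avoid_anti {l : ℝ} (hl : 0 < l) (ω : OffspringField) (x) :
    Antitone fun m => avoid l ω m x := by
  refine antitone_nat_of_succ_le fun m => ?_
  induction m generalizing x with
  | zero =>
    simp only [avoid, Finset.sum_const, Finset.card_range, nsmul_eq_mul, mul_one]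
    refine div_le_one_of_le₀ ?_ (by positivity)
    cases x with
    | nil => simp [parentValue, hl.le]
    | cons i x => simp [parentValue]
  | succ m ih =>
    have h1 : parentValue 0 (avoid l ω (m + 1)) x ≤ parentValue 0 (avoid l ω m) x := by
      cases x with
      | nil => exact le_rfl
      | cons i x => exact ih x
    have h2 : ∑ i ∈ Finset.range (ω x), avoid l ω (m + 1) (i :: x) ≤
        ∑ i ∈ Finset.range (ω x), avoid l ω m (i :: x) := Finset.sum_le_sum fun i _ => ih _
    exact div_le_div_of_nonneg_right (add_le_add (mul_le_mul_of_nonneg_left h1 hl.le) h2)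
      (by positivity)

/-- `returnProd` is harmonic in the tree with value `1` at `e^*`, so it dominates the hitting
probabilities. -/
theorem one_sub_avoid_le {l : ℝ} (hl : 0 < l) (ω : OffspringField) (m x) :
    1 - avoid l ω m x ≤ returnProd l ω x := by
  have hr0 : ∀ x, 0 ≤ returnProd l ω x := by
    intro x
    induction x with
    | nil => exact sub_nonneg.2 (escapeLimit_le_one hl _)
    | cons i x ih => exact mul_nonneg (sub_nonneg.2 (escapeLimit_le_one hl _)) ih
  induction m generalizing x with
  | zero => simpa [avoid] using hr0 x
  | succ m ih =>
    set b := escapeLimit l (descend ω x) with hb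
    set U := parentValue 1 (returnProd l ω) x with hU
    have hx : returnProd l ω x = (1 - b) * U := by
      cases x with
      | nil => simp [returnProd, hU, parentValue, hb]
      | cons i x => simp [returnProd, hU, parentValue, hb]
    have hbS := escapeLimit_eq hl (descend ω x)
    rw [childSum_descend, ← hb] at hbS
    set S := ∑ i ∈ Finset.range (ω x), escapeLimit l (descend ω (i :: x)) with hS
    have hS0 : 0 ≤ S := Finset.sum_nonneg fun i _ => escapeLimit_nonneg hl _
    have hsum : ∑ i ∈ Finset.range (ω x), (1 - avoid l ω m (i :: x)) ≤
        (ω x - S) * ((1 - b) * U) := by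
      calc _ ≤ ∑ i ∈ Finset.range (ω x), returnProd l ω (i :: x) :=
            Finset.sum_le_sum fun i _ => ih _
        _ = _ := by
          simp only [returnProd, ← Finset.sum_mul, Finset.sum_sub_distrib, hx, ← hS]
          simp
    simp only [Finset.sum_sub_distrib, Finset.sum_const, Finset.card_range, nsmul_eq_mul,
      mul_one] at hsum
    have hpar : 1 - parentValue 0 (avoid l ω m) x ≤ U := by
      cases x with
      | nil => simp [parentValue, hU]
      | cons i x => exact ih x
    have hbl : (1 - b) * (l + S) = l := by
      rw [hbS]; field_simp; ring
    rw [hx, avoid, sub_le_iff_le_add, ← sub_le_iff_le_add', le_div_iff₀ (by positivity)]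
    have h1 := mul_le_mul_of_nonneg_left hpar hl.le
    have h2 : (1 - b) * U * (l + ω x) = l * U + (ω x - S) * ((1 - b) * U) := by
      linear_combination U * hbl
    nlinarith

/-- The limit `h` of `avoid` is harmonic. Induction on `n` shows that the return probability `1 - h`
is at least `1 - escapeIter` at `x` times its value at the parent, which gives `h [] ≤ escapeLimit`. -/
theorem tendsto_avoid_nil {l : ℝ} (hl : 0 < l) (ω : OffspringField) :
    Tendsto (fun m => avoid l ω m []) atTop (𝓝 (escapeLimit l ω)) := by
  have hbdd : ∀ x, BddBelow (Set.range fun m => avoid l ω m x) := fun x =>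
    ⟨0, by rintro _ ⟨m, rfl⟩; exact avoid_nonneg hl ω m x⟩
  have ht : ∀ x, Tendsto (fun m => avoid l ω m x) atTop (𝓝 (⨅ m, avoid l ω m x)) := fun x =>
    tendsto_atTop_ciInf (avoid_anti hl ω x) (hbdd x)
  set h : List ℕ → ℝ := fun x => ⨅ m, avoid l ω m x with hh
  have h1 : ∀ x, h x ≤ 1 := fun x => ciInf_le (hbdd x) 0
  have hpar : ∀ x, Tendsto (fun m => parentValue 0 (avoid l ω m) x) atTop
      (𝓝 (parentValue 0 h x)) := by
    intro x
    cases x with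
    | nil => exact tendsto_const_nhds
    | cons i x => exact ht x
  have hharm : ∀ x, h x * (l + ω x) =
      l * parentValue 0 h x + ∑ i ∈ Finset.range (ω x), h (i :: x) := by
    intro x
    have e1 := (tendsto_add_atTop_iff_nat 1).2 (ht x)
    have e2 : Tendsto (fun m => avoid l ω (m + 1) x) atTop (𝓝 ((l * parentValue 0 h x +
        ∑ i ∈ Finset.range (ω x), h (i :: x)) / (l + ω x))) :=
      (((hpar x).const_mul l).add (tendsto_finsetSum _ fun i _ => ht _)).div_const _
    rw [← eq_div_iff (by positivity)]
    exact tendsto_nhds_unique e1 e2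
  have hup : ∀ n x, (1 - escapeIter l (fun _ => 1) n (descend ω x)) *
      (1 - parentValue 0 h x) ≤ 1 - h x := by
    intro n
    induction n with
    | zero => intro x; simpa [escapeIter] using h1 x
    | succ n ih =>
      intro x
      simp only [escapeIter, childSum_descend]
      set S := ∑ i ∈ Finset.range (ω x), escapeIter l (fun _ => 1) n (descend ω (i :: x)) with hS
      have hS0 : 0 ≤ S :=
        Finset.sum_nonneg fun i _ => escapeIter_nonneg hl (fun _ => zero_le_one) _ _
      have hsum : (ω x - S) * (1 - h x) ≤ ω x - ∑ i ∈ Finset.range (ω x), h (i :: x) := by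
        have := Finset.sum_le_sum fun i (_ : i ∈ Finset.range (ω x)) => ih (i :: x)
        simpa [parentValue, ← Finset.sum_mul, Finset.sum_sub_distrib, ← hS] using this
      have e : 1 - S / (l + S) = l / (l + S) := by field_simp; ring
      rw [e, div_mul_eq_mul_div, div_le_iff₀ (by positivity)]
      have := hharm x
      nlinarith
  have hle : h [] ≤ escapeLimit l ω := by
    refine le_ciInf fun n => ?_
    have := hup n []
    simp only [parentValue, descend_nil, sub_zero, mul_one] at this
    linarith
  have hge : escapeLimit l ω ≤ h [] := by
    refine le_ciInf fun m => ?_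
    have := one_sub_avoid_le hl ω m []
    simp only [returnProd, descend_nil] at this
    linarith
  rw [← le_antisymm hle hge]
  exact ht []

instance (ω : OffspringField) : Countable (Vertex ω) :=
  Function.Injective.countable (f := Vertex.word) fun _ _ h => Vertex.ext h

theorem children_star_root (ω : OffspringField) :
    ((tree ω).star.finite_children (tree ω).star.root).toFinset = {some (tree ω).root} := by
  ext y
  simp only [Set.Finite.mem_toFinset, Finset.mem_singleton]
  cases y with
  | none => simp [LocFinRootedTree.star]
  | some v =>
    have := (tree ω).parent_eq_none_iff v
    simpa [LocFinRootedTree.star] using this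

theorem numChildren_star_root (ω : OffspringField) :
    (tree ω).star.numChildren (tree ω).star.root = 1 := by
  rw [LocFinRootedTree.numChildren_eq_card, children_star_root, Finset.card_singleton]

/-- The child `i` of an individual. -/
def child {ω : OffspringField} (v : Vertex ω) (i : Fin (ω v.word)) : Vertex ω :=
  ⟨i.1 :: v.word, v.isVertex, i.2⟩

theorem child_injective {ω : OffspringField} (v : Vertex ω) : Function.Injective (child v) :=
  fun _ _ h => Fin.ext (List.cons.inj (congrArg Vertex.word h)).1

theorem children_star_some (ω : OffspringField) (v : Vertex ω) :
    ((tree ω).star.finite_children (some v)).toFinset =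
      Finset.univ.map ((⟨child v, child_injective v⟩ : _ ↪ Vertex ω).trans
        Function.Embedding.some) := by
  ext y
  simp only [Set.Finite.mem_toFinset, Finset.mem_map, Finset.mem_univ, true_and]
  change (tree ω).star.parent y = some (some v) ↔ _
  constructor
  · intro h
    rcases y with _ | ⟨_ | ⟨i, x⟩, hx⟩
    · cases h
    · cases h
    · cases h
      exact ⟨⟨i, hx.2⟩, rfl⟩
  · rintro ⟨i, rfl⟩
    rfl

theorem numChildren_star_some (ω : OffspringField) (v : Vertex ω) :
    (tree ω).star.numChildren (some v) = ω v.word := by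
  rw [LocFinRootedTree.numChildren_eq_card, children_star_some]
  simp

theorem killedStep_star_some {l : ℝ} (hl : 0 < l) (ω : OffspringField) (m : ℕ) (v : Vertex ω) :
    ((tree ω).star.killedStep l {none}ᶜ)^[m] (fun _ => 1) (some v) =
      ENNReal.ofReal (avoid l ω m v.word) := by
  have hroot : (tree ω).star.numChildren (tree ω).star.root ≠ 0 := by
    rw [numChildren_star_root]; exact one_ne_zero
  induction m generalizing v with
  | zero => simp [avoid]
  | succ m ih =>
    rw [Function.iterate_succ_apply']
    set f := ((tree ω).star.killedStep l {none}ᶜ)^[m] (fun _ => 1) with hf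
    have hind : ∀ u : Vertex ω, ({none}ᶜ : Set (Option (Vertex ω))).indicator f (some u) =
        ENNReal.ofReal (avoid l ω m u.word) := fun u => by
      rw [Set.indicator_of_mem (by simp), ih]
    have hnone : ({none}ᶜ : Set (Option (Vertex ω))).indicator f none = 0 :=
      Set.indicator_of_notMem (by simp) _
    have hpar : ∃ w, (tree ω).star.parent (some v) = some w ∧
        ({none}ᶜ : Set (Option (Vertex ω))).indicator f w =
          ENNReal.ofReal (parentValue 0 (avoid l ω m) v.word) := by
      rcases v with ⟨_ | ⟨i, x⟩, hx⟩
      · exact ⟨none, rfl, by rw [hnone]; simp [parentValue]⟩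
      · exact ⟨some ⟨x, hx.1⟩, rfl, by rw [hind]; rfl⟩
    obtain ⟨w, hw, hwf⟩ := hpar
    have hpv : 0 ≤ parentValue 0 (avoid l ω m) v.word := by
      cases v.word with
      | nil => exact le_rfl
      | cons i x => exact avoid_nonneg hl ω m x
    rw [LocFinRootedTree.killedStep, LocFinRootedTree.lintegral_stepKernel_of_parent _ hl hroot hw,
      hwf, children_star_some, numChildren_star_some, Finset.sum_map, ← Finset.mul_sum]
    simp only [Function.Embedding.trans_apply, Function.Embedding.some_apply,
      Function.Embedding.coeFn_mk, hind]
    rw [← ENNReal.ofReal_sum_of_nonneg fun i _ => avoid_nonneg hl ω m _,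
      ← ENNReal.ofReal_mul (by positivity),
      ← ENNReal.ofReal_mul (by positivity), avoid,
      ← ENNReal.ofReal_add (by positivity)
        (mul_nonneg (by positivity) (Finset.sum_nonneg fun i _ => avoid_nonneg hl ω m _))]
    congr 1
    simp only [child, Finset.sum_range]
    ring

theorem killedStep_star_none {l : ℝ} (hl : 0 < l) (ω : OffspringField) (m : ℕ) :
    ((tree ω).star.killedStep l {none}ᶜ)^[m + 1] (fun _ => 1) none =
      ENNReal.ofReal (avoid l ω m []) := by
  have hroot : (tree ω).star.numChildren (tree ω).star.root ≠ 0 := by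
    rw [numChildren_star_root]; exact one_ne_zero
  rw [Function.iterate_succ_apply', LocFinRootedTree.killedStep]
  have := LocFinRootedTree.lintegral_stepKernel_root (tree ω).star hl hroot
    (({none}ᶜ : Set (Option (Vertex ω))).indicator
      (((tree ω).star.killedStep l {none}ᶜ)^[m] (fun _ => 1)))
  rw [children_star_root, numChildren_star_root, Finset.sum_singleton, Set.indicator_of_mem (by simp),
    killedStep_star_some hl] at this
  refine this.trans ?_
  simp [tree]

theorem escapeProb_eq {l : ℝ} (hl : 0 < l) (ω : OffspringField) :
    escapeProb l ω = escapeLimit l ω := by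
  set μ := (tree ω).star.walkLaw l with hμ
  have : IsProbabilityMeasure μ := by
    rw [hμ]; unfold LocFinRootedTree.walkLaw LocFinRootedTree.walkLawFrom; infer_instance
  let S : ℕ → Set (ℕ → Option (Vertex ω)) := fun m =>
    {Z | ∀ j, 1 ≤ j → j ≤ m → Z j ∈ ({none}ᶜ : Set (Option (Vertex ω)))}
  have hSm : ∀ m, MeasurableSet (S m) := fun m => by
    simp only [S, Set.ofPred_forall]
    exact .iInter fun j => .iInter fun _ => .iInter fun _ => measurable_pi_apply j .of_discrete
  have hset : {Z | returnTime (tree ω).star.root Z = ⊤} = ⋂ m, S m := by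
    ext Z
    simp only [Set.mem_ofPred_eq, returnTime_eq_top_iff, Set.mem_iInter, S]
    exact ⟨fun h m j hj _ => h j hj, fun h j hj => h j j hj le_rfl⟩
  have hanti : Antitone S := fun m n hmn Z hZ j h1 h2 => hZ j h1 (h2.trans hmn)
  have h1 : Tendsto (fun m => μ (S m)) atTop (𝓝 (μ (⋂ m, S m))) :=
    tendsto_measure_iInter_atTop (fun m => (hSm m).nullMeasurableSet) hanti
      ⟨0, measure_ne_top _ _⟩
  have h2 : ∀ m, μ (S (m + 1)) = ENNReal.ofReal (avoid l ω m []) := fun m => by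
    have := (tree ω).star.setLIntegral_walkLawFrom l (tree ω).star.root {none}ᶜ (m + 1)
      (fun _ => 1)
    rw [setLIntegral_one] at this
    exact this.trans (killedStep_star_none hl ω m)
  have h3 := (tendsto_add_atTop_iff_nat 1).2 h1
  simp_rw [h2] at h3
  have h4 := tendsto_nhds_unique h3 (ENNReal.tendsto_ofReal (tendsto_avoid_nil hl ω))
  rw [escapeProb, measureReal_def, hset, h4, ENNReal.toReal_ofReal (escapeLimit_nonneg hl ω)]

end GaltonWatson

/-! ### Continuity of the annealed escape probability -/

/-- For an offspring distribution with mean `μ > 1`, the annealed escape probability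
`l ↦ 𝔼[P_l^{T^*}(σ_{e^*} = ∞)]` is well defined and continuous on `(λ_c, μ)`. -/
theorem proposition2p9 (p : PMF ℕ) (hp : 1 < GaltonWatson.mean p) :
    (∀ l : ℝ, GaltonWatson.criticalBias p < l → ENNReal.ofReal l < GaltonWatson.mean p →
      Integrable (GaltonWatson.escapeProb l) (GaltonWatson.survivalLaw p)) ∧
    ContinuousOn
      (fun l : ℝ => ∫ ω, GaltonWatson.escapeProb l ω ∂(GaltonWatson.survivalLaw p))
      {l : ℝ | GaltonWatson.criticalBias p < l ∧ ENNReal.ofReal l < GaltonWatson.mean p} := by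
  have hfin : IsFiniteMeasure (GaltonWatson.survivalLaw p) := by
    unfold GaltonWatson.survivalLaw; infer_instance
  have hmeas : ∀ l : ℝ, 0 < l → AEStronglyMeasurable (GaltonWatson.escapeProb l)
      (GaltonWatson.survivalLaw p) := fun l hl => by
    rw [funext (GaltonWatson.escapeProb_eq hl)]
    exact GaltonWatson.measurable_escapeLimit.aestronglyMeasurable
  have hbound : ∀ l : ℝ, 0 < l → ∀ ω, ‖GaltonWatson.escapeProb l ω‖ ≤ 1 := fun l hl ω => by
    rw [GaltonWatson.escapeProb_eq hl, Real.norm_of_nonneg (GaltonWatson.escapeLimit_nonneg hl ω)]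
    exact GaltonWatson.escapeLimit_le_one hl ω
  have hpos : ∀ l : ℝ, GaltonWatson.criticalBias p < l → 0 < l := fun l hl =>
    (GaltonWatson.criticalBias_nonneg hp).trans_lt hl
  refine ⟨fun l hl _ => ?_, fun l hl => ContinuousAt.continuousWithinAt ?_⟩
  · exact Integrable.of_bound (hmeas l (hpos l hl)) 1 (ae_of_all _ (hbound l (hpos l hl)))
  · have hl0 := hpos l hl.1
    have hev : ∀ᶠ x in nhds l, 0 < x := lt_mem_nhds hl0
    refine continuousAt_of_dominated (bound := fun _ => 1) (hev.mono hmeas)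
      (hev.mono fun x hx => ae_of_all _ (hbound x hx)) (integrable_const _) ?_
    have hac : GaltonWatson.survivalLaw p ≪ GaltonWatson.law p :=
      ProbabilityTheory.cond_absolutelyContinuous
    filter_upwards [hac.ae_le (GaltonWatson.ae_continuousAt_escapeLimit hp hl0 hl.2)] with ω hω
    refine hω.congr ?_
    filter_upwards [hev] with x hx
    exact (GaltonWatson.escapeProb_eq hx ω).symm
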